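/- A compact metric graph $\Gamma$ consists of finitely many vertices and finitely many edges (loops and parallel edges are allowed), each edge $e$ being identified with an interval $[0,\ell_e]$, $\ell_e>0$, whose end points are glued to the end vertices of $e$; it is assumed to be connected. Let $\operatorname{dist}$ be the shortest-path distance on $\Gamma$, let $\mathrm{d}x$ be Lebesgue measure on each edge, let $|\Gamma|=\sum_e \ell_e$ be the total length, and, if $|\Gamma|>0$, let $$\rho(\Gamma)=\frac{1}{|\Gamma|^2}\int_\Gamma\int_\Gamma \operatorname{dist}(x,y)\,\mathrm{d}y\,\mathrm{d}x$$ be the mean distance of $\Gamma$. An equilateral flower is a metric graph with exactly one vertex, all of whose edges (which are then loops at that vertex) have equal length. A path graph is an interval and a loop is a circle; in both, finitely many vertices of degree two may subdivide the graph into several edges. $\Gamma$ is doubly connected if it has no bridge, i.e. if removing any single edge (keeping all vertices) leaves the graph connected. Theorem. Let $\Gamma$ be a compact metric graph with total length $|\Gamma|=L>0$ and $E$ edges. Then $$\frac{2E-1}{4E^2}\,L\;\le\;\rho(\Gamma)\;\le\;\frac{L}{3},$$ with equality in the lower bound if and only if $\Gamma$ is an equilateral flower, and equality in the upper bound if and only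 if $\Gamma$ is a path graph. If $\Gamma$ is doubly connected, then moreover $$\rho(\Gamma)\le\frac{L}{4},$$ with equality if and only if $\Gamma$ is a loop. -/

import Mathlib

/-- A finite multigraph (loops and parallel edges allowed) with vertex set `V` and edge set `E`,
each edge `e` being parametrised by an interval `[0, len e]` of positive length, which runs from
the vertex `ini e` to the vertex `ter e`. The orientation serves only to parametrise. -/
structure MetricGraph (V E : Type*) where
  ini : E → V
  ter : E → V
  len : E → ℝ
  len_pos : ∀ e, 0 < len e

namespace MetricGraph

variable {V E : Type*} (G : MetricGraph V E)

/-- The unordered pair of end vertices of an edge. -/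
def ends (e : E) : Sym2 V := s(G.ini e, G.ter e)

/-- The vertices `u` and `v` are joined by a walk (of any orientation) all of whose edges
belong to `S`. -/
def JoinedIn (S : Set E) (u v : V) : Prop :=
  Relation.ReflTransGen (fun a b => ∃ e ∈ S, G.ends e = s(a, b)) u v

/-- The graph is connected. -/
def Connected : Prop :=
  Nonempty V ∧ ∀ u v, G.JoinedIn Set.univ u v

/-- An edge is a bridge if its removal (keeping all vertices) disconnects the graph. -/
def IsBridge (e : E) : Prop :=
  ∃ u v, ¬ G.JoinedIn {e}ᶜ u v

/-- A graph is doubly connected if it is connected and has no bridge. -/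
def DoublyConnected : Prop :=
  G.Connected ∧ ∀ e, ¬ G.IsBridge e

/-- The disjoint union of the vertices and of the parametrising intervals of the edges. -/
abbrev PrePoint : Type _ := V ⊕ (Σ e : E, Set.Icc (0 : ℝ) (G.len e))

/-- The end points of each parametrising interval are glued to the end vertices of the edge. -/
inductive Glue : G.PrePoint → G.PrePoint → Prop
  | ini (e : E) : Glue (Sum.inr ⟨e, ⟨0, le_rfl, (G.len_pos e).le⟩⟩) (Sum.inl (G.ini e))
  | ter (e : E) : Glue (Sum.inr ⟨e, ⟨G.len e, (G.len_pos e).le, le_rfl⟩⟩) (Sum.inl (G.ter e))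

/-- The points of the metric graph. -/
def Point : Type _ := Quot G.Glue

/-- The point with parameter `t` on the edge `e`. -/
def onEdge (e : E) (t : Set.Icc (0 : ℝ) (G.len e)) : G.Point :=
  Quot.mk _ (Sum.inr ⟨e, t⟩)

/-- `G.HasPath p q r`: there is a path from `p` to `q` of length `r`, composed of finitely many
segments, each of which lies in one edge and has its Euclidean length there. -/
inductive HasPath : G.Point → G.Point → ℝ → Prop
  | refl (p : G.Point) : HasPath p p 0
  | step (e : E) (s t : Set.Icc (0 : ℝ) (G.len e)) (q : G.Point) (r : ℝ) :
      HasPath (G.onEdge e t) q r →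
        HasPath (G.onEdge e s) q (|(s : ℝ) - (t : ℝ)| + r)

/-- The shortest-path distance. -/
noncomputable def dist (p q : G.Point) : ℝ := sInf {r | G.HasPath p q r}

section Finite

variable [Fintype E]

/-- The total length. -/
noncomputable def totalLength : ℝ := ∑ e, G.len e

/-- The integral of a function over the metric graph, with respect to Lebesgue measure on each
edge. -/
noncomputable def integral (f : G.Point → ℝ) : ℝ :=
  ∑ e, ∫ t : Set.Icc (0 : ℝ) (G.len e), f (G.onEdge e t)
    ∂(MeasureTheory.Measure.comap Subtype.val MeasureTheory.volume)

/-- The mean distance from a point. -/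
noncomputable def meanDistFrom (p : G.Point) : ℝ :=
  1 / G.totalLength * G.integral (fun q => G.dist p q)

/-- The mean distance of the metric graph. -/
noncomputable def meanDist : ℝ :=
  1 / G.totalLength * G.integral G.meanDistFrom

end Finite

/-- An equilateral flower: there is exactly one vertex (so all edges are loops at it), and all
edges have the same length. -/
def IsEquilateralFlower : Prop :=
  (∃ c : V, ∀ v, v = c) ∧ ∀ e f, G.len e = G.len f

/-- A path graph, that is, an interval, possibly with vertices of degree two in its interior:
the vertices are `v 0, …, v n`, pairwise distinct, and the edges are `e 0, …, e (n - 1)` where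
`e i` joins `v i` and `v (i + 1)`. -/
def IsPathGraph : Prop :=
  ∃ (n : ℕ) (v : Fin (n + 1) ≃ V) (e : Fin n ≃ E),
    ∀ i : Fin n, G.ends (e i) = s(v i.castSucc, v i.succ)

/-- A loop (circle), possibly subdivided by vertices of degree two: for some `n`, the vertices
are `v 0, …, v n`, pairwise distinct, and the edges are `e 0, …, e n`, where `e i` joins `v i`
and `v (i + 1)`, the index `i + 1` being read modulo `n + 1`. For `n = 0` this is one edge from a
vertex to itself, for `n = 1` it is a pair of parallel edges. -/
def IsLoop : Prop :=
  ∃ (n : ℕ) (v : Fin (n + 1) ≃ V) (e : Fin (n + 1) ≃ E),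
    ∀ i : Fin (n + 1), G.ends (e i) = s(v i, v (i + 1))

end MetricGraph

/-!
The mean distance of `G` is the double integral `G.distInt₂` of the distance over all edges, divided
by the square of the total length `L`. All three bounds are obtained by comparing the distance with
explicit functions on the edges. Since the distance is continuous, equality of the integrals gives
pointwise equality, which determines the extremal graphs.

*Upper bound* `L / 3`. A connected graph arises from a vertex by adding edges one by one
(`MetricGraph.Built`). A new edge of length `l` attached at `v` contributes at most
`l ^ 3 / 3 + 2 * (L' * l ^ 2 / 2 + l * D v)` to the double integral, where `L'` is the length so far
and `D v ≤ L' ^ 2 / 2` is the integral of the distance from `v`; so the difference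
`distInt₂ - length ^ 3 / 3` does not increase (`Built.distInt₂_insert_le`). In the case of equality
every added edge is attached at a vertex with `D v = L' ^ 2 / 2` and leads to a new vertex
(`Built.extremal`). For a longest simple path this means that a further edge would extend it at one
of its ends, so that the path is the whole graph.

*Upper bound* `L / 4`. Fix a point `p`. On each edge, the distance from `p` is at most a tent
function, and a tent attains each value `r` once for every interval in a pair of intervals. As there
is no bridge, two edges lead from the vertices at distance at most `r` to those at distance more
than `r`, so that these intervals cover `[0, R)` twice, `R` being the maximum of the tents
(`DoublyConnected.two_le_card`). Integrating `R - r` against the covering number bounds the integral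
of the distance from `p` by `R * L - R ^ 2 ≤ L ^ 2 / 4`. If three sides of edges meet at `p`, then
`[0, ε)` is covered three times and the inequality is strict (`DoublyConnected.distInt_lt`); so in
the case of equality a longest simple path closes up to a loop, which is the whole graph.

*Lower bound.* Gluing all vertices together does not increase distances (`Connected.flowerDist_le`),
and decreases them unless there is only one vertex. This gives the double integral
`(2 * L * ∑ l ^ 2 - ∑ l ^ 3) / 4` of a flower, which is minimal for edges of equal length
(`cubic_lower_bound`).

Conversely, a path and a loop map without expanding distances onto an interval and a circle of the
same length (`Connected.le_distInt₂_of_trail`), whose mean distances are `L / 3` and `L / 4`.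
-/

namespace MetricGraph

/-! ### The shortest-path distance -/

section Distance

variable {V E : Type*} {G : MetricGraph V E}

variable (G) in
/-- The point of the metric graph given by a vertex. -/
def vtx (v : V) : G.Point := Quot.mk _ (Sum.inl v)

variable (G) in
/-- The point with parameter `t` on the edge `e`, for an arbitrary real `t`, which is projected to
the parameter interval of `e`. -/
noncomputable def pt (e : E) (t : ℝ) : G.Point :=
  G.onEdge e (Set.projIcc 0 (G.len e) (G.len_pos e).le t)

lemma onEdge_eq_pt (e : E) (t : Set.Icc (0 : ℝ) (G.len e)) : G.onEdge e t = G.pt e t := by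
  rw [pt, Set.projIcc_val]

lemma pt_zero (e : E) : G.pt e 0 = G.vtx (G.ini e) := by
  rw [pt, Set.projIcc_left]
  exact Quot.sound (Glue.ini e)

lemma pt_len (e : E) : G.pt e (G.len e) = G.vtx (G.ter e) := by
  rw [pt, Set.projIcc_right]
  exact Quot.sound (Glue.ter e)

lemma HasPath.trans {p q s : G.Point} {r r' : ℝ} (h : G.HasPath p q r) (h' : G.HasPath q s r') :
    G.HasPath p s (r + r') := by
  induction h with
  | refl p => simpa using h'
  | step e a b q r _ ih =>
    rw [add_assoc]
    exact HasPath.step e a b _ _ (ih h')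

lemma HasPath.symm {p q : G.Point} {r : ℝ} (h : G.HasPath p q r) : G.HasPath q p r := by
  induction h with
  | refl p => exact HasPath.refl p
  | step e a b q r _ ih =>
    have := ih.trans (HasPath.step e b a _ _ (HasPath.refl _))
    rwa [add_zero, add_comm, abs_sub_comm] at this

lemma HasPath.nonneg {p q : G.Point} {r : ℝ} (h : G.HasPath p q r) : 0 ≤ r := by
  induction h with
  | refl p => exact le_rfl
  | step e a b q r _ ih => positivity

lemma hasPath_pt (e : E) (s t : Set.Icc (0 : ℝ) (G.len e)) :
    G.HasPath (G.onEdge e s) (G.onEdge e t) |(s : ℝ) - t| := by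
  simpa using HasPath.step e s t _ _ (HasPath.refl _)

lemma exists_hasPath_of_ends {e : E} {a b : V} (h : G.ends e = s(a, b)) :
    ∃ r, G.HasPath (G.vtx a) (G.vtx b) r := by
  have key : ∃ r, G.HasPath (G.vtx (G.ini e)) (G.vtx (G.ter e)) r := by
    rw [← pt_zero, ← pt_len]
    exact ⟨_, hasPath_pt e _ _⟩
  obtain ⟨r, hr⟩ := key
  rcases Sym2.eq_iff.1 h with ⟨rfl, rfl⟩ | ⟨rfl, rfl⟩
  exacts [⟨r, hr⟩, ⟨r, hr.symm⟩]

lemma JoinedIn.exists_hasPath {S : Set E} {u v : V} (h : G.JoinedIn S u v) :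
    ∃ r, G.HasPath (G.vtx u) (G.vtx v) r := by
  induction h with
  | refl => exact ⟨0, HasPath.refl _⟩
  | tail _ hbc ih =>
    obtain ⟨r, hr⟩ := ih
    obtain ⟨e, -, he⟩ := hbc
    obtain ⟨r', hr'⟩ := exists_hasPath_of_ends he
    exact ⟨_, hr.trans hr'⟩

lemma exists_hasPath_vtx (p : G.Point) : ∃ v r, G.HasPath p (G.vtx v) r := by
  induction p using Quot.ind with
  | mk a =>
    rcases a with v | ⟨e, t⟩
    · exact ⟨v, 0, HasPath.refl _⟩
    · refine ⟨G.ini e, |(t : ℝ) - (⟨0, le_rfl, (G.len_pos e).le⟩ : Set.Icc (0 : ℝ) (G.len e))|, ?_⟩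
      rw [← pt_zero, pt, Set.projIcc_left]
      exact hasPath_pt e _ _

lemma Connected.exists_hasPath (hG : G.Connected) (p q : G.Point) : ∃ r, G.HasPath p q r := by
  obtain ⟨u, r, hr⟩ := exists_hasPath_vtx p
  obtain ⟨v, r', hr'⟩ := exists_hasPath_vtx q
  obtain ⟨r'', hr''⟩ := (hG.2 u v).exists_hasPath
  exact ⟨_, (hr.trans hr'').trans hr'.symm⟩

lemma dist_le_of_hasPath {p q : G.Point} {r : ℝ} (h : G.HasPath p q r) : G.dist p q ≤ r :=
  csInf_le ⟨0, fun _ h => HasPath.nonneg h⟩ h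

lemma dist_nonneg (p q : G.Point) : 0 ≤ G.dist p q :=
  Real.sInf_nonneg fun _ h => HasPath.nonneg h

lemma dist_self (p : G.Point) : G.dist p p = 0 :=
  le_antisymm (dist_le_of_hasPath (HasPath.refl p)) (dist_nonneg p p)

lemma dist_comm (p q : G.Point) : G.dist p q = G.dist q p := by
  unfold dist
  congr 1
  ext r
  exact ⟨HasPath.symm, HasPath.symm⟩

lemma Connected.dist_triangle (hG : G.Connected) (p q s : G.Point) :
    G.dist p s ≤ G.dist p q + G.dist q s := by
  refine le_of_forall_pos_le_add fun ε hε => ?_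
  obtain ⟨r, hr, hr1⟩ : ∃ r, G.HasPath p q r ∧ r < G.dist p q + ε / 2 :=
    Real.lt_sInf_add_pos (hG.exists_hasPath p q) (half_pos hε)
  obtain ⟨r', hr', hr1'⟩ : ∃ r, G.HasPath q s r ∧ r < G.dist q s + ε / 2 :=
    Real.lt_sInf_add_pos (hG.exists_hasPath q s) (half_pos hε)
  have := dist_le_of_hasPath (hr.trans hr')
  linarith

lemma dist_pt_le (e : E) (s t : ℝ) : G.dist (G.pt e s) (G.pt e t) ≤ |s - t| :=
  (dist_le_of_hasPath (hasPath_pt e _ _)).trans (Set.abs_projIcc_sub_projIcc _)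

lemma Connected.abs_dist_sub_le (hG : G.Connected) (p p' q q' : G.Point) :
    |G.dist p q - G.dist p' q'| ≤ G.dist p p' + G.dist q q' := by
  have h1 := hG.dist_triangle p p' q
  have h2 := hG.dist_triangle p' q' q
  have h3 := hG.dist_triangle p' p q'
  have h4 := hG.dist_triangle p q q'
  rw [dist_comm q' q] at h2
  rw [dist_comm p' p] at h3
  rw [abs_le]
  constructor <;> linarith

/-- A map that is given on the vertices and on each edge, compatibly, and that does not expand
lengths on the edges, does not expand distances. -/
theorem Connected.exists_lift {X : Type*} [PseudoMetricSpace X] (hG : G.Connected) (χ : V → X)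
    (γ : E → ℝ → X) (h0 : ∀ e, γ e 0 = χ (G.ini e)) (h1 : ∀ e, γ e (G.len e) = χ (G.ter e))
    (hγ : ∀ e, ∀ s ∈ Set.Icc 0 (G.len e), ∀ t ∈ Set.Icc 0 (G.len e),
      Dist.dist (γ e s) (γ e t) ≤ |s - t|) :
    ∃ φ : G.Point → X, (∀ v, φ (G.vtx v) = χ v) ∧
      (∀ e, ∀ t ∈ Set.Icc 0 (G.len e), φ (G.pt e t) = γ e t) ∧
      ∀ p q, Dist.dist (φ p) (φ q) ≤ G.dist p q := by
  let φ₀ : G.PrePoint → X := Sum.elim χ fun x => γ x.1 x.2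
  have hφ₀ : ∀ a b, G.Glue a b → φ₀ a = φ₀ b := by
    intro a b hab
    cases hab with
    | ini e => exact h0 e
    | ter e => exact h1 e
  let φ : G.Point → X := Quot.lift φ₀ hφ₀
  have hφ : ∀ p q r, G.HasPath p q r → Dist.dist (φ p) (φ q) ≤ r := by
    intro p q r h
    induction h with
    | refl p => simp
    | step e s t q r _ ih =>
      exact (_root_.dist_triangle _ _ _).trans (add_le_add (hγ e s s.2 t t.2) ih)
  refine ⟨φ, fun v => rfl, fun e t ht => ?_, fun p q => ?_⟩
  · rw [pt, Set.projIcc_of_mem _ ht]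
    rfl
  · exact le_csInf (hG.exists_hasPath p q) fun r hr => hφ p q r hr

/-- A function on the vertices, extended linearly to the edges, bounds the distance below. -/
theorem Connected.abs_sub_le_dist_vtx (hG : G.Connected) (χ : V → ℝ)
    (hχ : ∀ e, |χ (G.ini e) - χ (G.ter e)| ≤ G.len e) (u v : V) :
    |χ u - χ v| ≤ G.dist (G.vtx u) (G.vtx v) := by
  obtain ⟨φ, h1, -, h3⟩ := hG.exists_lift χ
    (fun e t => χ (G.ini e) + t * ((χ (G.ter e) - χ (G.ini e)) / G.len e)) (by simp)
    (fun e => by have := (G.len_pos e).ne'; field_simp; ring) (by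
      intro e s _ t _
      have hl := G.len_pos e
      rw [Real.dist_eq, add_sub_add_left_eq_sub, ← sub_mul, abs_mul, abs_div, abs_of_pos hl]
      refine mul_le_of_le_one_right (abs_nonneg _) ((div_le_one hl).2 ?_)
      rw [abs_sub_comm]
      exact hχ e)
  simpa [h1, Real.dist_eq] using h3 (G.vtx u) (G.vtx v)

lemma Connected.dist_vtx_pos [Finite E] (hG : G.Connected) {u v : V} (huv : u ≠ v) :
    0 < G.dist (G.vtx u) (G.vtx v) := by
  classical
  obtain ⟨ε, hε, hεl⟩ : ∃ ε > 0, ∀ e, ε ≤ G.len e := by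
    cases isEmpty_or_nonempty E with
    | inl _ => exact ⟨1, one_pos, isEmptyElim⟩
    | inr _ =>
      obtain ⟨e, he⟩ := Finite.exists_min G.len
      exact ⟨_, G.len_pos e, he⟩
  have := hG.abs_sub_le_dist_vtx (fun w => if w = u then ε else 0) (fun e => by
    have := hεl e
    have := G.len_pos e
    split_ifs <;> simp [abs_of_pos hε] <;> linarith) u v
  simp only [if_true, if_neg huv.symm, sub_zero, abs_of_pos hε] at this
  linarith

lemma Connected.eq_univ_of_closed (hG : G.Connected) {W : Set V} (hW : W.Nonempty)
    (h : ∀ e, G.ini e ∈ W ↔ G.ter e ∈ W) : W = Set.univ := by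
  obtain ⟨w, hw⟩ := hW
  refine Set.eq_univ_of_forall fun v => ?_
  have := hG.2 w v
  induction this with
  | refl => exact hw
  | tail _ hbc ih =>
    obtain ⟨e, -, he⟩ := hbc
    rcases Sym2.eq_iff.1 he with ⟨rfl, rfl⟩ | ⟨rfl, rfl⟩
    exacts [(h e).1 ih, (h e).2 ih]

end Distance

/-! ### Integrals of the distance -/

section Integrals

open intervalIntegral

variable {V E : Type*} {G : MetricGraph V E}

lemma Connected.continuous_dist_pt (hG : G.Connected) (e f : E) :
    Continuous fun x : ℝ × ℝ => G.dist (G.pt e x.1) (G.pt f x.2) := by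
  refine continuous_iff_continuousAt.2 fun x => ?_
  have h : Filter.Tendsto (fun y : ℝ × ℝ => |y.1 - x.1| + |y.2 - x.2|) (nhds x) (nhds 0) := by
    have : Continuous fun y : ℝ × ℝ => |y.1 - x.1| + |y.2 - x.2| := by fun_prop
    simpa using this.tendsto x
  rw [ContinuousAt, tendsto_iff_dist_tendsto_zero]
  refine squeeze_zero (fun _ => _root_.dist_nonneg) (fun y => ?_) h
  rw [Real.dist_eq]
  exact (hG.abs_dist_sub_le _ _ _ _).trans (add_le_add (dist_pt_le _ _ _) (dist_pt_le _ _ _))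

lemma Connected.continuous_dist_pt_right (hG : G.Connected) (p : G.Point) (f : E) :
    Continuous fun t : ℝ => G.dist p (G.pt f t) := by
  refine (LipschitzWith.of_dist_le_mul (K := 1) fun s t => ?_).continuous
  rw [Real.dist_eq, Real.dist_eq, NNReal.coe_one, one_mul]
  refine (hG.abs_dist_sub_le _ _ _ _).trans ?_
  rw [dist_self, zero_add]
  exact dist_pt_le _ _ _

variable (G) in
/-- The integral of the distance from `p` over the edges in `S`. -/
noncomputable def distInt (S : Finset E) (p : G.Point) : ℝ :=
  ∑ f ∈ S, ∫ t in 0..G.len f, G.dist p (G.pt f t)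

variable (G) in
/-- The double integral of the distance over the edges in `S`. -/
noncomputable def distInt₂ (S : Finset E) : ℝ :=
  ∑ e ∈ S, ∫ s in 0..G.len e, G.distInt S (G.pt e s)

variable (G) in
/-- The total length of the edges in `S`. -/
noncomputable def length (S : Finset E) : ℝ := ∑ e ∈ S, G.len e

lemma length_nonneg (S : Finset E) : 0 ≤ G.length S :=
  Finset.sum_nonneg fun e _ => (G.len_pos e).le

lemma length_pos {S : Finset E} (hS : S.Nonempty) : 0 < G.length S :=
  Finset.sum_pos (fun e _ => G.len_pos e) hS

lemma Connected.integral_dist_le (hG : G.Connected) (p q : G.Point) (f : E) :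
    ∫ t in 0..G.len f, G.dist p (G.pt f t) ≤
      G.dist p q * G.len f + ∫ t in 0..G.len f, G.dist q (G.pt f t) := by
  have hc := hG.continuous_dist_pt_right
  calc ∫ t in 0..G.len f, G.dist p (G.pt f t)
      ≤ ∫ t in 0..G.len f, (G.dist p q + G.dist q (G.pt f t)) :=
        integral_mono_on (G.len_pos f).le ((hc p f).intervalIntegrable _ _)
          ((continuous_const.add (hc q f)).intervalIntegrable _ _)
          fun t _ => hG.dist_triangle _ _ _
    _ = _ := by
      rw [integral_add (continuous_const.intervalIntegrable _ _)
        ((hc q f).intervalIntegrable _ _), integral_const, sub_zero, smul_eq_mul, mul_comm]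

lemma Connected.distInt_le (hG : G.Connected) (S : Finset E) (p q : G.Point) :
    G.distInt S p ≤ G.dist p q * G.length S + G.distInt S q := by
  rw [distInt, length, Finset.mul_sum, distInt, ← Finset.sum_add_distrib]
  exact Finset.sum_le_sum fun f _ => hG.integral_dist_le p q f

lemma Connected.continuous_distInt (hG : G.Connected) (S : Finset E) (e : E) :
    Continuous fun s : ℝ => G.distInt S (G.pt e s) := by
  refine (LipschitzWith.of_dist_le_mul (K := (G.length S).toNNReal) fun s t => ?_).continuous
  have h1 := hG.distInt_le S (G.pt e s) (G.pt e t)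
  have h2 := hG.distInt_le S (G.pt e t) (G.pt e s)
  rw [dist_comm] at h2
  have h3 := mul_le_mul_of_nonneg_right (G.dist_pt_le e s t) (G.length_nonneg S)
  rw [Real.dist_eq, Real.dist_eq, Real.coe_toNNReal _ (G.length_nonneg S), abs_le, mul_comm]
  constructor <;> linarith

/-- Two continuous functions, one below the other, with the same integral agree. -/
lemma eqOn_of_integral_eq {f g : ℝ → ℝ} {a b : ℝ} (hab : a < b) (hf : Continuous f)
    (hg : Continuous g) (hle : ∀ t ∈ Set.Icc a b, f t ≤ g t)
    (h : ∫ t in a..b, g t ≤ ∫ t in a..b, f t) : ∀ t ∈ Set.Icc a b, f t = g t := by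
  by_contra! hne
  obtain ⟨t, ht, htne⟩ := hne
  exact absurd (integral_lt_integral_of_continuousOn_of_le_of_exists_lt hab hf.continuousOn
    hg.continuousOn (fun x hx => hle x ⟨hx.1.le, hx.2⟩) ⟨t, ht, lt_of_le_of_ne (hle t ht) htne⟩)
    (not_lt.2 h)

lemma integral_eq_sum [Fintype E] (f : G.Point → ℝ) :
    G.integral f = ∑ e, ∫ t in 0..G.len e, f (G.pt e t) := by
  refine Finset.sum_congr rfl fun e _ => ?_
  simp_rw [onEdge_eq_pt]
  rw [MeasureTheory.integral_subtype_comap measurableSet_Icc (fun t => f (G.pt e t)),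
    MeasureTheory.integral_Icc_eq_integral_Ioc, integral_of_le (G.len_pos e).le]

lemma meanDist_eq [Fintype E] :
    G.meanDist = G.distInt₂ Finset.univ / G.totalLength ^ 2 := by
  unfold meanDist meanDistFrom distInt₂ distInt
  simp_rw [integral_eq_sum, integral_const_mul, ← Finset.mul_sum]
  ring

end Integrals

/-! ### Adding edges one by one -/

section Built

open intervalIntegral

variable {V E : Type*} {G : MetricGraph V E}

lemma integral_abs_sub {l s : ℝ} (hs : s ∈ Set.Icc 0 l) :
    ∫ t in (0 : ℝ)..l, |t - s| = (s ^ 2 + (l - s) ^ 2) / 2 := by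
  have hc : Continuous fun t : ℝ => |t - s| := by fun_prop
  rw [← integral_add_adjacent_intervals (hc.intervalIntegrable 0 s) (hc.intervalIntegrable s l)]
  have h1 : ∫ t in (0 : ℝ)..s, |t - s| = ∫ t in (0 : ℝ)..s, (s - t) :=
    integral_congr fun t ht => by
      rw [Set.uIcc_of_le hs.1] at ht
      rw [abs_sub_comm, abs_of_nonneg (sub_nonneg.2 ht.2)]
  have h2 : ∫ t in s..l, |t - s| = ∫ t in s..l, (t - s) :=
    integral_congr fun t ht => by
      rw [Set.uIcc_of_le hs.2] at ht
      exact abs_of_nonneg (sub_nonneg.2 ht.1)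
  rw [h1, h2, integral_comp_sub_left (fun x => x), integral_comp_sub_right (fun x => x),
    integral_id, integral_id]
  ring

lemma integral_integral_abs_sub {l : ℝ} (hl : 0 ≤ l) :
    ∫ s in (0 : ℝ)..l, ∫ t in (0 : ℝ)..l, |t - s| = l ^ 3 / 3 := by
  have : ∫ s in (0 : ℝ)..l, ∫ t in (0 : ℝ)..l, |t - s| =
      ∫ s in (0 : ℝ)..l, (s ^ 2 + (l - s) ^ 2) / 2 :=
    integral_congr fun s hs => by
      rw [Set.uIcc_of_le hl] at hs
      exact integral_abs_sub hs
  rw [this, integral_div, integral_add ((continuous_pow 2).intervalIntegrable _ _)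
    ((by fun_prop : Continuous fun s : ℝ => (l - s) ^ 2).intervalIntegrable _ _),
    integral_comp_sub_left (fun x => x ^ 2), integral_pow,
    integral_pow]
  norm_num

variable (G) in
/-- The subgraphs that arise from a single vertex by adding edges one by one, each of them with
an end vertex among the previous ones. They are given by their sets of vertices and edges. -/
inductive Built [DecidableEq E] : Set V → Finset E → Prop
  | single (v : V) : Built {v} ∅
  | add {W : Set V} {S : Finset E} {e : E} {v w : V} (h : Built W S) (he : e ∉ S) (hv : v ∈ W)
      (hvw : G.ends e = s(v, w)) : Built (insert w W) (insert e S)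

/-- The ends `v` and `w` of an edge are its points with the parameters `τ` and `τ'`. -/
lemma exists_param {e : E} {v w : V} (h : G.ends e = s(v, w)) :
    ∃ τ τ', (τ = 0 ∧ τ' = G.len e ∨ τ = G.len e ∧ τ' = 0) ∧
      G.vtx v = G.pt e τ ∧ G.vtx w = G.pt e τ' := by
  rcases Sym2.eq_iff.1 h with ⟨rfl, rfl⟩ | ⟨rfl, rfl⟩
  · exact ⟨0, _, .inl ⟨rfl, rfl⟩, (pt_zero e).symm, (pt_len e).symm⟩
  · exact ⟨_, 0, .inr ⟨rfl, rfl⟩, (pt_len e).symm, (pt_zero e).symm⟩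

lemma integral_abs_sub_end {l τ : ℝ} (hl : 0 < l) (hτ : τ = 0 ∨ τ = l) :
    ∫ t in (0 : ℝ)..l, |t - τ| = l ^ 2 / 2 := by
  rw [integral_abs_sub] <;> rcases hτ with rfl | rfl
  · ring
  · ring
  · exact ⟨le_rfl, hl.le⟩
  · exact ⟨hl.le, le_rfl⟩

lemma Connected.integral_dist_pt_le (hG : G.Connected) (e : E) (s : ℝ) :
    ∫ t in 0..G.len e, G.dist (G.pt e s) (G.pt e t) ≤ ∫ t in 0..G.len e, |t - s| :=
  integral_mono_on (G.len_pos e).le ((hG.continuous_dist_pt_right _ e).intervalIntegrable _ _)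
    ((by fun_prop : Continuous fun t : ℝ => |t - s|).intervalIntegrable _ _)
    fun t _ => by rw [abs_sub_comm]; exact dist_pt_le _ _ _

lemma Connected.continuous_integral_dist (hG : G.Connected) (e f : E) :
    Continuous fun s : ℝ => ∫ t in 0..G.len f, G.dist (G.pt e s) (G.pt f t) :=
  continuous_parametric_intervalIntegral_of_continuous' (hG.continuous_dist_pt e f) _ _

lemma Connected.integral_integral_dist_le (hG : G.Connected) (e : E) :
    ∫ s in 0..G.len e, ∫ t in 0..G.len e, G.dist (G.pt e s) (G.pt e t) ≤ G.len e ^ 3 / 3 := by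
  rw [← integral_integral_abs_sub (G.len_pos e).le]
  exact integral_mono_on (G.len_pos e).le
    ((hG.continuous_integral_dist e e).intervalIntegrable _ _)
    ((continuous_parametric_intervalIntegral_of_continuous'
      (by fun_prop : Continuous fun x : ℝ × ℝ => |x.2 - x.1|) _ _).intervalIntegrable _ _)
    fun s _ => hG.integral_dist_pt_le e s

/-- Equality in `integral_integral_dist_le` forces the edge to be a shortest path between its
end vertices. -/
lemma Connected.dist_ends_eq_of_integral (hG : G.Connected) {e : E}
    (h : ∫ s in 0..G.len e, ∫ t in 0..G.len e, G.dist (G.pt e s) (G.pt e t) = G.len e ^ 3 / 3) :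
    G.dist (G.vtx (G.ini e)) (G.vtx (G.ter e)) = G.len e := by
  have hl := G.len_pos e
  rw [← integral_integral_abs_sub hl.le] at h
  have h1 := eqOn_of_integral_eq hl (hG.continuous_integral_dist e e)
    (continuous_parametric_intervalIntegral_of_continuous'
      (by fun_prop : Continuous fun x : ℝ × ℝ => |x.2 - x.1|) _ _)
    (fun s _ => hG.integral_dist_pt_le e s) h.ge 0 ⟨le_rfl, hl.le⟩
  have h2 := eqOn_of_integral_eq hl (hG.continuous_dist_pt_right (G.pt e 0) e)
    (by fun_prop : Continuous fun t : ℝ => |t - 0|)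
    (fun t _ => by rw [abs_sub_comm]; exact dist_pt_le _ _ _) h1.ge _ ⟨hl.le, le_rfl⟩
  rwa [pt_zero, pt_len, sub_zero, abs_of_pos hl] at h2

lemma distInt_insert [DecidableEq E] {S : Finset E} {e : E} (he : e ∉ S) (p : G.Point) :
    G.distInt (insert e S) p = (∫ t in 0..G.len e, G.dist p (G.pt e t)) + G.distInt S p :=
  Finset.sum_insert he

lemma length_insert [DecidableEq E] {S : Finset E} {e : E} (he : e ∉ S) :
    G.length (insert e S) = G.len e + G.length S :=
  Finset.sum_insert he

lemma Connected.distInt₂_insert [DecidableEq E] (hG : G.Connected) {S : Finset E} {e : E}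
    (he : e ∉ S) :
    G.distInt₂ (insert e S) = G.distInt₂ S + 2 * (∫ s in 0..G.len e, G.distInt S (G.pt e s)) +
      ∫ s in 0..G.len e, ∫ t in 0..G.len e, G.dist (G.pt e s) (G.pt e t) := by
  have hsplit : ∀ f, ∫ s in 0..G.len f, G.distInt (insert e S) (G.pt f s) =
      (∫ s in 0..G.len f, ∫ t in 0..G.len e, G.dist (G.pt f s) (G.pt e t)) +
        ∫ s in 0..G.len f, G.distInt S (G.pt f s) := by
    intro f
    simp_rw [distInt_insert he]
    exact integral_add ((hG.continuous_integral_dist f e).intervalIntegrable _ _)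
      ((hG.continuous_distInt S f).intervalIntegrable _ _)
  have hswap : ∑ f ∈ S, ∫ s in 0..G.len f, ∫ t in 0..G.len e, G.dist (G.pt f s) (G.pt e t) =
      ∫ s in 0..G.len e, G.distInt S (G.pt e s) := by
    simp_rw [distInt]
    rw [integral_finsetSum fun f _ => (hG.continuous_integral_dist e f).intervalIntegrable _ _]
    refine Finset.sum_congr rfl fun f _ => ?_
    rw [MeasureTheory.intervalIntegral_intervalIntegral_swap]
    · simp_rw [dist_comm]
    · exact ((hG.continuous_dist_pt f e).continuousOn.integrableOn_compact
        (isCompact_uIcc.prod isCompact_uIcc)).mono_set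
          (Set.prod_mono Set.uIoc_subset_uIcc Set.uIoc_subset_uIcc)
  rw [distInt₂, Finset.sum_insert he]
  simp_rw [hsplit]
  rw [Finset.sum_add_distrib, hswap, distInt₂]
  ring

lemma Connected.distInt_pt_le (hG : G.Connected) (S : Finset E) (e : E) (t τ : ℝ) :
    G.distInt S (G.pt e t) ≤ |t - τ| * G.length S + G.distInt S (G.pt e τ) :=
  (hG.distInt_le S _ (G.pt e τ)).trans (add_le_add_left
    (mul_le_mul_of_nonneg_right (dist_pt_le _ _ _) (length_nonneg S)) _)

lemma integral_abs_sub_mul_add {l τ : ℝ} (hl : 0 < l) (hτ : τ = 0 ∨ τ = l) (a b : ℝ) :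
    ∫ t in (0 : ℝ)..l, (|t - τ| * a + b) = l ^ 2 / 2 * a + l * b := by
  rw [integral_add ((by fun_prop : Continuous fun t : ℝ => |t - τ| * a).intervalIntegrable _ _)
    (continuous_const.intervalIntegrable _ _), integral_mul_const, integral_abs_sub_end hl hτ,
    integral_const, sub_zero, smul_eq_mul]

lemma Connected.integral_distInt_le (hG : G.Connected) (S : Finset E) {e : E} {v w : V}
    (h : G.ends e = s(v, w)) :
    ∫ t in 0..G.len e, G.distInt S (G.pt e t) ≤
      G.len e ^ 2 / 2 * G.length S + G.len e * G.distInt S (G.vtx v) := by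
  obtain ⟨τ, τ', hτ, hv, -⟩ := exists_param h
  rw [hv, ← integral_abs_sub_mul_add (G.len_pos e) (hτ.imp And.left And.left)]
  exact integral_mono_on (G.len_pos e).le ((hG.continuous_distInt S e).intervalIntegrable _ _)
    ((by fun_prop : Continuous fun t : ℝ =>
      |t - τ| * G.length S + G.distInt S (G.pt e τ)).intervalIntegrable _ _)
    fun t _ => hG.distInt_pt_le S e t τ

/-- Equality in `integral_distInt_le` forces every shortest path from the far end of the edge to
pass through the whole edge. -/
lemma Connected.distInt_far_end_eq (hG : G.Connected) (S : Finset E) {e : E} {v w : V}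
    (h : G.ends e = s(v, w))
    (heq : ∫ t in 0..G.len e, G.distInt S (G.pt e t) =
      G.len e ^ 2 / 2 * G.length S + G.len e * G.distInt S (G.vtx v)) :
    G.distInt S (G.vtx w) = G.len e * G.length S + G.distInt S (G.vtx v) := by
  obtain ⟨τ, τ', hτ, hv, hw⟩ := exists_param h
  have hl := G.len_pos e
  rw [hv, ← integral_abs_sub_mul_add hl (hτ.imp And.left And.left)] at heq
  have := eqOn_of_integral_eq hl (hG.continuous_distInt S e)
    (by fun_prop : Continuous fun t : ℝ => |t - τ| * G.length S + G.distInt S (G.pt e τ))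
    (fun t _ => hG.distInt_pt_le S e t τ) heq.ge τ'
    (by rcases hτ with ⟨rfl, rfl⟩ | ⟨rfl, rfl⟩ <;> exact ⟨by positivity, by linarith⟩)
  rw [hw, hv, this]
  rcases hτ with ⟨rfl, rfl⟩ | ⟨rfl, rfl⟩ <;> simp [abs_of_pos hl]

lemma dist_ends_le {e : E} {v w : V} (h : G.ends e = s(v, w)) :
    G.dist (G.vtx v) (G.vtx w) ≤ G.len e := by
  obtain ⟨τ, τ', hτ, hv, hw⟩ := exists_param h
  rw [hv, hw]
  refine (dist_pt_le _ _ _).trans ?_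
  rcases hτ with ⟨rfl, rfl⟩ | ⟨rfl, rfl⟩ <;> simp [abs_of_pos (G.len_pos e)]

lemma Connected.integral_dist_vtx_le (hG : G.Connected) {e : E} {v w : V}
    (h : G.ends e = s(v, w)) :
    ∫ t in 0..G.len e, G.dist (G.vtx v) (G.pt e t) ≤ G.len e ^ 2 / 2 := by
  obtain ⟨τ, τ', hτ, hv, -⟩ := exists_param h
  rw [hv, ← integral_abs_sub_end (G.len_pos e) (hτ.imp And.left And.left)]
  exact hG.integral_dist_pt_le e τ

lemma Built.ends_mem [DecidableEq E] {W : Set V} {S : Finset E} (h : G.Built W S) :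
    W.Nonempty ∧ ∀ e ∈ S, G.ini e ∈ W ∧ G.ter e ∈ W := by
  induction h with
  | single v => exact ⟨⟨v, rfl⟩, by simp⟩
  | @add W S e v w _ he hv hvw ih =>
    refine ⟨⟨w, .inl rfl⟩, fun f hf => ?_⟩
    rcases Finset.mem_insert.1 hf with rfl | hf
    · rcases Sym2.eq_iff.1 hvw with ⟨rfl, rfl⟩ | ⟨rfl, rfl⟩
      exacts [⟨.inr hv, .inl rfl⟩, ⟨.inl rfl, .inr hv⟩]
    · exact ⟨.inr (ih.2 f hf).1, .inr (ih.2 f hf).2⟩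

lemma Built.dist_le [DecidableEq E] (hG : G.Connected) {W : Set V} {S : Finset E}
    (h : G.Built W S) :
    ∀ u ∈ W, ∀ v ∈ W, G.dist (G.vtx u) (G.vtx v) ≤ G.length S := by
  induction h with
  | single v => rintro u rfl v rfl; simp [dist_self, length]
  | @add W S e v w _ he hv hvw ih =>
    have hl := G.len_pos e
    have hd := dist_ends_le hvw
    have key : ∀ u ∈ W, G.dist (G.vtx u) (G.vtx w) ≤ G.length (insert e S) := by
      intro u hu
      have := hG.dist_triangle (G.vtx u) (G.vtx v) (G.vtx w)
      have := ih u hu v hv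
      rw [length_insert he]
      linarith
    rintro x (rfl | hx) y (rfl | hy)
    · rw [dist_self]; exact length_nonneg _
    · rw [dist_comm]; exact key y hy
    · exact key x hx
    · rw [length_insert he]; linarith [ih x hx y hy]

lemma Built.distInt_le [DecidableEq E] (hG : G.Connected) {W : Set V} {S : Finset E}
    (h : G.Built W S) :
    ∀ u ∈ W, G.distInt S (G.vtx u) ≤ G.length S ^ 2 / 2 := by
  induction h with
  | single v => simp [distInt, length]
  | @add W S e v w hb he hv hvw ih =>
    have hl := G.len_pos e
    have hL := G.length_nonneg S
    have hv' := ih v hv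
    rintro u (rfl | hu) <;> rw [distInt_insert he, length_insert he]
    · have h1 := hG.distInt_le S (G.vtx u) (G.vtx v)
      have h2 := hG.integral_dist_vtx_le (hvw.trans Sym2.eq_swap)
      have h3 := dist_ends_le (hvw.trans Sym2.eq_swap)
      nlinarith [mul_le_mul_of_nonneg_right h3 hL]
    · have h1 := hG.integral_dist_le (G.vtx u) (G.vtx v) e
      have h2 := hG.integral_dist_vtx_le hvw
      have h3 := hb.dist_le hG u hu v hv
      nlinarith [mul_le_mul_of_nonneg_right h3 hl.le, ih u hu]

/-- Adding an edge does not increase the (nonpositive) difference between the double integral of the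
distance and its upper bound. -/
lemma Built.distInt₂_insert_le [DecidableEq E] (hG : G.Connected) {W : Set V} {S : Finset E}
    (h : G.Built W S)
    {e : E} {v w : V} (he : e ∉ S) (hv : v ∈ W) (hvw : G.ends e = s(v, w)) :
    G.distInt₂ (insert e S) - G.length (insert e S) ^ 3 / 3 ≤
      G.distInt₂ S - G.length S ^ 3 / 3 := by
  have h1 := hG.integral_distInt_le S hvw
  have h2 := hG.integral_integral_dist_le e
  have h3 := mul_le_mul_of_nonneg_left (h.distInt_le hG v hv) (G.len_pos e).le
  rw [hG.distInt₂_insert he, length_insert he]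
  linarith

lemma Built.distInt₂_le [DecidableEq E] (hG : G.Connected) {W : Set V} {S : Finset E}
    (h : G.Built W S) :
    G.distInt₂ S ≤ G.length S ^ 3 / 3 := by
  induction h with
  | single v => simp [distInt₂, length]
  | add hb he hv hvw ih => linarith [hb.distInt₂_insert_le hG he hv hvw]

lemma exists_ends_eq {e : E} {W : Set V} (h : G.ini e ∈ W ∨ G.ter e ∈ W) :
    ∃ v ∈ W, ∃ w, G.ends e = s(v, w) := by
  rcases h with h | h
  exacts [⟨_, h, _, rfl⟩, ⟨_, h, _, Sym2.eq_swap⟩]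

lemma Built.exists_edge [DecidableEq E] [Fintype E] (hG : G.Connected) {W : Set V} {S : Finset E}
    (h : G.Built W S) (hS : S ≠ Finset.univ) :
    ∃ e ∉ S, ∃ v ∈ W, ∃ w, G.ends e = s(v, w) := by
  obtain ⟨hW, hends⟩ := h.ends_mem
  by_contra! hno
  have hno' : ∀ e ∉ S, ¬ (G.ini e ∈ W ∨ G.ter e ∈ W) := fun e he hor => by
    obtain ⟨v, hv, w, hvw⟩ := exists_ends_eq hor
    exact hno e he v hv w hvw
  have := hG.eq_univ_of_closed hW fun e => by
    by_cases he : e ∈ S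
    · exact iff_of_true (hends e he).1 (hends e he).2
    · exact iff_of_false (fun h => hno' e he (.inl h)) fun h => hno' e he (.inr h)
  refine hS (Finset.eq_univ_of_forall fun e => ?_)
  by_contra he
  exact hno' e he (.inl (this ▸ Set.mem_univ _))

lemma Built.univ_defect_le [DecidableEq E] [Fintype E] (hG : G.Connected) {W : Set V} {S : Finset E}
    (h : G.Built W S) :
    G.distInt₂ Finset.univ - G.length Finset.univ ^ 3 / 3 ≤
      G.distInt₂ S - G.length S ^ 3 / 3 := by
  induction hn : Sᶜ.card generalizing W S with
  | zero =>
    rw [Finset.card_eq_zero, Finset.compl_eq_empty_iff] at hn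
    rw [hn]
  | succ n ih =>
    have hS : S ≠ Finset.univ := by
      rintro rfl
      simp at hn
    obtain ⟨e, he, v, hv, w, hvw⟩ := h.exists_edge hG hS
    refine (ih (h.add he hv hvw) ?_).trans (h.distInt₂_insert_le hG he hv hvw)
    rw [Finset.compl_insert, Finset.card_erase_of_mem (Finset.mem_compl.2 he), hn]
    rfl

theorem Connected.distInt₂_le [Fintype E] (hG : G.Connected) :
    G.distInt₂ Finset.univ ≤ G.length Finset.univ ^ 3 / 3 := by
  classical
  obtain ⟨v⟩ := hG.1
  have := (Built.single v : G.Built {v} ∅).univ_defect_le hG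
  simp only [distInt₂, length, Finset.sum_empty] at this ⊢
  linarith

/-- In the case of equality in the upper bound for the whole graph, every edge outside the subgraph
is attached at a vertex of maximal mean distance, and leads to a new vertex. -/
lemma Built.extremal [DecidableEq E] [Fintype E] (hG : G.Connected)
    (hF : G.distInt₂ Finset.univ = G.length Finset.univ ^ 3 / 3) {W : Set V} {S : Finset E}
    (h : G.Built W S) {e : E} {v w : V} (he : e ∉ S) (hv : v ∈ W) (hvw : G.ends e = s(v, w)) :
    G.distInt S (G.vtx v) = G.length S ^ 2 / 2 ∧ w ∉ W := by
  have hl := G.len_pos e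
  have h0 := (h.add he hv hvw).univ_defect_le hG
  have h1 := hG.integral_distInt_le S hvw
  have h2 := hG.integral_integral_dist_le e
  have h3 := h.distInt_le hG v hv
  have h3' := mul_le_mul_of_nonneg_left h3 hl.le
  have h4 := h.distInt₂_le hG
  rw [hG.distInt₂_insert he, length_insert he] at h0
  have h5 : G.len e * G.distInt S (G.vtx v) = G.len e * (G.length S ^ 2 / 2) := by linarith
  have h5' := mul_left_cancel₀ hl.ne' h5
  refine ⟨h5', fun hw => ?_⟩
  have h6 := hG.distInt_far_end_eq S hvw (by linarith)
  have h7 := h.distInt_le hG w hw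
  have h8 : G.length S ≤ 0 := by
    by_contra! hpos
    nlinarith [mul_pos hl hpos]
  -- The subgraph has length zero, hence just one vertex, and `e` is a loop at it.
  have h9 := h.dist_le hG v hv w hw
  have h10 := hG.dist_ends_eq_of_integral (e := e) (by linarith)
  have h11 : G.dist (G.vtx v) (G.vtx w) = G.len e := by
    rcases Sym2.eq_iff.1 hvw with ⟨rfl, rfl⟩ | ⟨rfl, rfl⟩
    exacts [h10, (dist_comm _ _).trans h10]
  linarith

end Built

/-! ### Simple paths and graphs of maximal mean distance -/

section Path

variable {V E : Type*} {G : MetricGraph V E}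

variable (G) in
/-- The vertices `v 0, …, v n` are pairwise distinct and the edge `e i` joins `v i` and
`v (i + 1)` for `i < n`. The values of `v` and `e` at larger indices play no role. -/
def IsSimplePath (n : ℕ) (v : ℕ → V) (e : ℕ → E) : Prop :=
  (∀ i ≤ n, ∀ j ≤ n, v i = v j → i = j) ∧ ∀ i < n, G.ends (e i) = s(v i, v (i + 1))

variable {n : ℕ} {v : ℕ → V} {e : ℕ → E}

lemma IsSimplePath.edge_injOn (h : G.IsSimplePath n v e) {i j : ℕ} (hi : i < n) (hj : j < n)
    (hij : e i = e j) : i = j := by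
  have h1 := h.2 i hi
  rw [hij, h.2 j hj] at h1
  rcases Sym2.eq_iff.1 h1 with ⟨h2, -⟩ | ⟨h2, h3⟩
  · exact (h.1 _ hj.le _ hi.le h2).symm
  · have := h.1 _ hj.le _ hi h2
    have := h.1 _ hj _ hi.le h3
    omega

lemma IsSimplePath.reverse (h : G.IsSimplePath n v e) :
    G.IsSimplePath n (fun i => v (n - i)) (fun i => e (n - 1 - i)) := by
  refine ⟨fun i hi j hj hij => ?_, fun i hi => ?_⟩
  · have := h.1 _ (Nat.sub_le n i) _ (Nat.sub_le n j) hij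
    omega
  · dsimp only
    rw [h.2 _ (by omega), Sym2.eq_swap, show n - 1 - i + 1 = n - i by omega,
      show n - 1 - i = n - (i + 1) by omega]

lemma IsSimplePath.extend (h : G.IsSimplePath n v e) {f : E} {w : V}
    (hf : G.ends f = s(v n, w)) (hw : ∀ i ≤ n, v i ≠ w) :
    ∃ v' e', G.IsSimplePath (n + 1) v' e' := by
  refine ⟨fun i => if i ≤ n then v i else w, fun i => if i < n then e i else f,
    fun i hi j hj hij => ?_, fun i hi => ?_⟩
  · by_cases h1 : i ≤ n <;> by_cases h2 : j ≤ n <;> simp only [h1, h2, if_true, if_false] at hij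
    · exact h.1 i h1 j h2 hij
    · exact absurd hij (hw i h1)
    · exact absurd hij.symm (hw j h2)
    · omega
  · rcases Nat.lt_succ_iff_lt_or_eq.1 hi with h1 | rfl
    · simp [h1, h1.le, Nat.succ_le_of_lt h1, h.2 i h1]
    · simp [hf]

lemma IsSimplePath.lt_card [Fintype V] (h : G.IsSimplePath n v e) : n < Fintype.card V := by
  have := Fintype.card_le_of_injective (fun i : Fin (n + 1) => v i) fun i j hij =>
    Fin.ext (h.1 i (Nat.lt_succ_iff.1 i.2) j (Nat.lt_succ_iff.1 j.2) hij)
  rwa [Fintype.card_fin] at this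

variable (G) in
/-- A simple path with the maximal number of edges. -/
def IsLongestPath (n : ℕ) (v : ℕ → V) (e : ℕ → E) : Prop :=
  G.IsSimplePath n v e ∧ ∀ m v' e', G.IsSimplePath m v' e' → m ≤ n

lemma exists_isLongestPath [Fintype V] [Nonempty V] [Nonempty E] :
    ∃ n v e, G.IsLongestPath n v e := by
  classical
  let P : ℕ → Prop := fun n => ∃ v e, G.IsSimplePath n v e
  have h0 : P 0 := ⟨fun _ => Classical.arbitrary V, fun _ => Classical.arbitrary E,
    fun i hi j hj _ => by omega, by simp⟩
  obtain ⟨v, e, h⟩ := Nat.findGreatest_spec (Nat.zero_le (Fintype.card V)) h0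
  exact ⟨_, v, e, h, fun m v' e' h' => Nat.le_findGreatest h'.lt_card.le ⟨v', e', h'⟩⟩

lemma IsLongestPath.exists_eq (h : G.IsLongestPath n v e) {f : E} {w : V}
    (hf : G.ends f = s(v n, w)) : ∃ i ≤ n, v i = w := by
  by_contra! hw
  obtain ⟨v', e', h'⟩ := h.1.extend hf hw
  have := h.2 _ _ _ h'
  omega

lemma IsLongestPath.reverse (h : G.IsLongestPath n v e) :
    G.IsLongestPath n (fun i => v (n - i)) (fun i => e (n - 1 - i)) :=
  ⟨h.1.reverse, h.2⟩

lemma IsSimplePath.built [DecidableEq E] (h : G.IsSimplePath n v e) {i j : ℕ} (hij : i ≤ j)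
    (hj : j ≤ n) :
    G.Built (v '' Set.Icc i j) ((Finset.Ico i j).image e) := by
  induction j, hij using Nat.le_induction with
  | base => simpa using Built.single (G := G) (v i)
  | succ j hij ih =>
    have := (ih (by omega)).add (e := e j) (v := v j) (w := v (j + 1)) ?_
      ⟨j, ⟨hij, le_rfl⟩, rfl⟩ (h.2 j hj)
    · convert this using 1
      · rw [← Set.image_insert_eq]
        congr 1
        ext k
        simp only [Set.mem_Icc, Set.mem_insert_iff]
        omega
      · rw [← Finset.image_insert]
        congr 1
        ext k
        simp only [Finset.mem_Ico, Finset.mem_insert]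
        omega
    · simp only [Finset.mem_image, Finset.mem_Ico, not_exists, not_and]
      intro k hk hke
      have := h.edge_injOn (by omega) (by omega) hke
      omega

/-- Seen from an inner vertex of a simple path, the mean distance of the path is not maximal. -/
lemma IsSimplePath.distInt_lt [DecidableEq E] (h : G.IsSimplePath n v e)
    (hG : G.Connected) {i : ℕ} (h0 : 0 < i)
    (hn : i < n) :
    G.distInt ((Finset.Ico 0 n).image e) (G.vtx (v i)) <
      G.length ((Finset.Ico 0 n).image e) ^ 2 / 2 := by
  have h1 := (h.built h0.le hn.le).distInt_le hG (v i) ⟨i, ⟨h0.le, le_rfl⟩, rfl⟩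
  have h2 := (h.built hn.le le_rfl).distInt_le hG (v i) ⟨i, ⟨le_rfl, hn.le⟩, rfl⟩
  have hu : (Finset.Ico 0 n).image e = (Finset.Ico 0 i).image e ∪ (Finset.Ico i n).image e := by
    rw [← Finset.image_union, Finset.Ico_union_Ico_eq_Ico h0.le hn.le]
  have hd : Disjoint ((Finset.Ico 0 i).image e) ((Finset.Ico i n).image e) := by
    simp only [Finset.disjoint_left, Finset.mem_image, Finset.mem_Ico, not_exists, not_and]
    rintro _ ⟨k, hk, rfl⟩ l hl hkl
    have := h.edge_injOn (by omega) (by omega) hkl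
    omega
  have h3 : 0 < G.length ((Finset.Ico 0 i).image e) :=
    length_pos (Finset.Nonempty.image ⟨0, by simp [h0]⟩ e)
  have h4 : 0 < G.length ((Finset.Ico i n).image e) :=
    length_pos (Finset.Nonempty.image ⟨i, by simp [hn]⟩ e)
  have h5 := mul_pos h3 h4
  have h6 : ∀ p, G.distInt ((Finset.Ico 0 n).image e) p =
      G.distInt ((Finset.Ico 0 i).image e) p + G.distInt ((Finset.Ico i n).image e) p := fun p => by
    rw [hu]; exact Finset.sum_union hd
  have h7 : G.length ((Finset.Ico 0 n).image e) =
      G.length ((Finset.Ico 0 i).image e) + G.length ((Finset.Ico i n).image e) := by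
    rw [hu]; exact Finset.sum_union hd
  rw [h6, h7]
  linarith

theorem Connected.isPathGraph_of_distInt₂_eq [Fintype V] [Fintype E] [Nonempty E]
    (hG : G.Connected) (hF : G.distInt₂ Finset.univ = G.length Finset.univ ^ 3 / 3) :
    G.IsPathGraph := by
  classical
  have := hG.1
  obtain ⟨n, v, e, h⟩ := exists_isLongestPath (G := G)
  have hb := h.1.built (Nat.zero_le n) le_rfl
  have hS : (Finset.Ico 0 n).image e = Finset.univ := by
    by_contra hne
    obtain ⟨f, hf, _, ⟨i, hi, rfl⟩, w, hw⟩ := hb.exists_edge hG hne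
    obtain ⟨h1, h2⟩ := hb.extremal hG hF hf ⟨i, hi, rfl⟩ hw
    have hi' : i = n ∨ i = 0 := by
      by_contra! hi'
      exact (h.1.distInt_lt hG (Nat.pos_of_ne_zero hi'.2) (lt_of_le_of_ne hi.2 hi'.1)).ne h1
    rcases hi' with rfl | rfl
    · obtain ⟨j, hj, rfl⟩ := h.exists_eq hw
      exact h2 ⟨j, ⟨Nat.zero_le _, hj⟩, rfl⟩
    · obtain ⟨j, hj, rfl⟩ := h.reverse.exists_eq (f := f) (w := w) (by simpa using hw)
      exact h2 ⟨n - j, ⟨Nat.zero_le _, Nat.sub_le _ _⟩, rfl⟩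
  rw [hS] at hb
  have hW := hG.eq_univ_of_closed hb.ends_mem.1 fun f =>
    iff_of_true (hb.ends_mem.2 f (Finset.mem_univ f)).1 (hb.ends_mem.2 f (Finset.mem_univ f)).2
  refine ⟨n, Equiv.ofBijective (fun i => v i) ⟨fun i j hij => ?_, fun x => ?_⟩,
    Equiv.ofBijective (fun i => e i) ⟨fun i j hij => ?_, fun f => ?_⟩, fun i => ?_⟩
  · exact Fin.ext (h.1.1 i (Nat.lt_succ_iff.1 i.2) j (Nat.lt_succ_iff.1 j.2) hij)
  · obtain ⟨i, hi, rfl⟩ := hW.ge (Set.mem_univ x)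
    exact ⟨⟨i, Nat.lt_succ_iff.2 hi.2⟩, rfl⟩
  · exact Fin.ext (h.1.edge_injOn i.2 j.2 hij)
  · obtain ⟨i, hi, rfl⟩ := Finset.mem_image.1 (hS.ge (Finset.mem_univ f))
    exact ⟨⟨i, (Finset.mem_Ico.1 hi).2⟩, rfl⟩
  · exact h.1.2 i i.2

end Path

/-! ### The mean distance of paths and loops -/

section Trail

open intervalIntegral

variable {V E : Type*} {G : MetricGraph V E}

/-- The positions of the edges when they are laid out one after the other on the line. -/
lemma exists_positions {m : ℕ} (e : Fin m ≃ E) :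
    ∃ pos : ℕ → ℝ, pos 0 = 0 ∧ ∀ i : Fin m, pos (i + 1) = pos i + G.len (e i) :=
  ⟨fun k => ∑ i ∈ Finset.range k, if h : i < m then G.len (e ⟨i, h⟩) else 0, by simp,
    fun i => by simp [Finset.sum_range_succ]⟩

lemma pos_last [Fintype E] {m : ℕ} (e : Fin m ≃ E) {pos : ℕ → ℝ} (h0 : pos 0 = 0)
    (hpos : ∀ i : Fin m, pos (i + 1) = pos i + G.len (e i)) : pos m = G.length Finset.univ := by
  have key : ∀ k (hk : k ≤ m), pos k = ∑ i : Fin k, G.len (e (Fin.castLE hk i)) := by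
    intro k
    induction k with
    | zero => simpa using h0
    | succ k ih =>
      intro hk
      rw [Fin.sum_univ_castSucc, hpos ⟨k, hk⟩, ih (by omega)]
      rfl
  rw [key m le_rfl, length]
  exact Equiv.sum_comp e G.len

/-- If the edges of `G` can be laid out one after the other along a curve `c` that does not expand
distances, then `G` maps to the curve without expanding distances, and the mean distance of `G` is
at least that of the curve. -/
theorem Connected.le_distInt₂_of_trail [Fintype E] {X : Type*} [PseudoMetricSpace X]
    (hG : G.Connected) {m : ℕ} (e : Fin m ≃ E) (pos : ℕ → ℝ) (hpos0 : pos 0 = 0)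
    (hpos : ∀ i : Fin m, pos (i + 1) = pos i + G.len (e i)) (c : ℝ → X)
    (hc : ∀ s t, Dist.dist (c s) (c t) ≤ |s - t|) (a b : Fin m → V)
    (hab : ∀ i, G.ends (e i) = s(a i, b i)) (χ : V → X) (ha : ∀ i, χ (a i) = c (pos i))
    (hb : ∀ i, χ (b i) = c (pos (i + 1))) :
    ∫ x in (0 : ℝ)..G.length Finset.univ, ∫ y in (0 : ℝ)..G.length Finset.univ,
      Dist.dist (c x) (c y) ≤ G.distInt₂ Finset.univ := by
  classical
  have hcc : Continuous c := (LipschitzWith.of_dist_le_mul (K := 1) fun s t => by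
    simpa [Real.dist_eq] using hc s t).continuous
  have hpm := pos_last e hpos0 hpos
  -- The edge `f` is run through in the direction in which it is laid out along the curve.
  let γ : E → ℝ → X := fun f t =>
    if G.ini f = a (e.symm f) ∧ G.ter f = b (e.symm f) then c (pos (e.symm f) + t)
    else c (pos (e.symm f + 1) - t)
  have hpos' : ∀ f, pos (e.symm f + 1) = pos (e.symm f) + G.len f := fun f => by
    rw [hpos, Equiv.apply_symm_apply]
  have hends : ∀ f, ¬ (G.ini f = a (e.symm f) ∧ G.ter f = b (e.symm f)) →
      G.ini f = b (e.symm f) ∧ G.ter f = a (e.symm f) := fun f hf => by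
    have := hab (e.symm f)
    rw [Equiv.apply_symm_apply] at this
    exact (Sym2.eq_iff.1 this).resolve_left hf
  obtain ⟨φ, -, hφ, hφd⟩ := hG.exists_lift χ γ (fun f => by
      dsimp only [γ]
      split_ifs with h
      · rw [h.1, ha, add_zero]
      · rw [(hends f h).1, hb, sub_zero]) (fun f => by
      dsimp only [γ]
      split_ifs with h
      · rw [h.2, hb, hpos']
      · rw [(hends f h).2, ha, hpos', add_sub_cancel_right]) (fun f s _ t _ => by
      dsimp only [γ]
      split_ifs
      · simpa using hc (pos (e.symm f) + s) (pos (e.symm f) + t)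
      · refine (hc _ _).trans_eq ?_
        rw [sub_sub_sub_cancel_left, abs_sub_comm])
  have hint : ∀ h : X → ℝ, Continuous h →
      ∑ f, ∫ t in 0..G.len f, h (φ (G.pt f t)) =
        ∫ x in (0 : ℝ)..G.length Finset.univ, h (c x) := by
    intro h hh
    have hhc := hh.comp hcc
    have h1 : ∀ f, ∫ t in 0..G.len f, h (φ (G.pt f t)) =
        ∫ x in pos (e.symm f)..pos (e.symm f + 1), h (c x) := by
      intro f
      have h2 : ∫ t in 0..G.len f, h (φ (G.pt f t)) = ∫ t in 0..G.len f, h (γ f t) :=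
        integral_congr fun t ht => by
          rw [Set.uIcc_of_le (G.len_pos f).le] at ht
          exact congrArg h (hφ f t ht)
      rw [h2]
      dsimp only [γ]
      split_ifs
      · rw [integral_comp_add_left (fun x => h (c x)), hpos', add_zero]
      · rw [integral_comp_sub_left (fun x => h (c x)), hpos', add_sub_cancel_right, sub_zero]
    simp_rw [h1]
    rw [← hpm, ← hpos0, ← sum_integral_adjacent_intervals (f := fun x => h (c x))
      fun k _ => hhc.intervalIntegrable (pos k) (pos (k + 1)), Finset.sum_range]
    exact Equiv.sum_comp e.symm
      (fun i : Fin m => ∫ x in pos (i : ℕ)..pos (i + 1), h (c x))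
  have hg : Continuous fun ξ : X => ∫ y in (0 : ℝ)..G.length Finset.univ, Dist.dist ξ (c y) :=
    continuous_parametric_intervalIntegral_of_continuous'
      (by fun_prop : Continuous fun x : X × ℝ => Dist.dist x.1 (c x.2)) _ _
  rw [← hint _ hg]
  refine Finset.sum_le_sum fun f _ => integral_mono_on (G.len_pos f).le ?_
    ((hG.continuous_distInt _ f).intervalIntegrable _ _) fun s _ => ?_
  · have hφc : Continuous fun t : ℝ => φ (G.pt f t) :=
      (LipschitzWith.of_dist_le_mul (K := 1) fun s t => by
        simpa [Real.dist_eq] using (hφd _ _).trans (dist_pt_le f s t)).continuous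
    exact (hg.comp hφc).intervalIntegrable _ _
  · rw [← hint _ (by fun_prop)]
    refine Finset.sum_le_sum fun f' _ => integral_mono_on (G.len_pos f').le ?_
      ((hG.continuous_dist_pt_right _ f').intervalIntegrable _ _) fun t _ => hφd _ _
    have hφc : Continuous fun t : ℝ => φ (G.pt f' t) :=
      (LipschitzWith.of_dist_le_mul (K := 1) fun s t => by
        simpa [Real.dist_eq] using (hφd _ _).trans (dist_pt_le f' s t)).continuous
    exact (continuous_const.dist hφc).intervalIntegrable _ _

theorem IsPathGraph.le_distInt₂ [Fintype E] (h : G.IsPathGraph) (hG : G.Connected) :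
    G.length Finset.univ ^ 3 / 3 ≤ G.distInt₂ Finset.univ := by
  obtain ⟨n, v, e, h⟩ := h
  obtain ⟨pos, h0, hpos⟩ := exists_positions (G := G) e
  refine le_trans (le_of_eq ?_) (hG.le_distInt₂_of_trail e pos h0 hpos id
    (fun s t => (Real.dist_eq s t).le) (fun i => v i.castSucc) (fun i => v i.succ) h
    (fun w => pos (v.symm w)) (by simp) (by simp))
  rw [← integral_integral_abs_sub (length_nonneg _)]
  simp [Real.dist_eq, abs_sub_comm]

lemma integral_norm_addCircle {l : ℝ} (hl : 0 < l) (s : ℝ) :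
    ∫ t in (0 : ℝ)..l, ‖((t - s : ℝ) : AddCircle l)‖ = l ^ 2 / 4 := by
  have hper : Function.Periodic (fun t : ℝ => ‖(t : AddCircle l)‖) l := fun t => by
    simp
  rw [integral_comp_sub_right (fun t : ℝ => ‖(t : AddCircle l)‖) s]
  have h1 := hper.intervalIntegral_add_eq (0 - s) (-(l / 2))
  rw [show (0 - s) + l = l - s by ring, show -(l / 2) + l = l / 2 by ring] at h1
  have h2 : ∫ t in -(l / 2)..l / 2, ‖(t : AddCircle l)‖ = ∫ t in -(l / 2)..l / 2, |t - 0| :=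
    integral_congr fun t ht => by
      rw [Set.uIcc_of_le (by linarith)] at ht
      simp only [sub_zero]
      rw [AddCircle.norm_coe_eq_abs_iff l hl.ne', abs_of_pos hl]
      exact abs_le.2 ht
  have h3 := integral_comp_sub_right (a := 0) (b := l) (fun t => |t - 0|) (l / 2)
  simp only [sub_zero] at h2 h3
  rw [h1, h2, show l / 2 = l - l / 2 by ring, show -(l - l / 2) = 0 - l / 2 by ring, ← h3,
    integral_abs_sub ⟨by linarith, by linarith⟩]
  ring

theorem IsLoop.le_distInt₂ [Fintype E] (h : G.IsLoop) (hG : G.Connected) :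
    G.length Finset.univ ^ 3 / 4 ≤ G.distInt₂ Finset.univ := by
  obtain ⟨n, v, e, h⟩ := h
  obtain ⟨pos, h0, hpos⟩ := exists_positions (G := G) e
  set L := G.length Finset.univ with hLdef
  have hL : 0 < L := length_pos ⟨e 0, Finset.mem_univ _⟩
  have hn : pos (n + 1) = L := pos_last e h0 hpos
  refine le_trans (le_of_eq ?_) (hG.le_distInt₂_of_trail e pos h0 hpos
    (fun x => (x : AddCircle L)) (fun s t => ?_) (fun i => v i) (fun i => v (i + 1)) h
    (fun w => (pos (v.symm w) : AddCircle L)) (by simp) fun i => ?_)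
  · have : ∀ x : ℝ, ∫ y in (0 : ℝ)..L, Dist.dist (x : AddCircle L) (y : AddCircle L) =
        L ^ 2 / 4 := fun x => by
      rw [← integral_norm_addCircle hL x]
      simp_rw [_root_.dist_comm (x : AddCircle L), dist_eq_norm, ← AddCircle.coe_sub]
    simp_rw [← hLdef, this]
    rw [integral_const, smul_eq_mul]
    ring
  · rw [dist_eq_norm, ← AddCircle.coe_sub]
    exact QuotientAddGroup.norm_mk_le_norm
  · rw [Equiv.symm_apply_apply]
    rcases Fin.eq_castSucc_or_eq_last i with ⟨j, rfl⟩ | rfl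
    · simp
    · simp [h0, hn, AddCircle.coe_period]

end Trail

/-! ### Counting points at a given distance -/

section Count

open MeasureTheory

lemma setIntegral_Ico_linear {R x M : ℝ} (hxM : x ≤ M) :
    ∫ r in Set.Ico x M, (R - r) = R * (M - x) - (M ^ 2 - x ^ 2) / 2 := by
  rw [integral_Ico_eq_integral_Ioc, ← intervalIntegral.integral_of_le hxM,
    intervalIntegral.integral_comp_sub_left (fun t => t), integral_id]
  ring

lemma setIntegral_indicator_Ico {R x M : ℝ} (hx : 0 ≤ x) (hxM : x ≤ M) (hM : M ≤ R) :
    ∫ r in Set.Ico 0 R, (Set.Ico x M).indicator (fun r => R - r) r =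
      R * (M - x) - (M ^ 2 - x ^ 2) / 2 := by
  rw [setIntegral_indicator measurableSet_Ico,
    Set.inter_eq_self_of_subset_right (Set.Ico_subset_Ico hx hM), setIntegral_Ico_linear hxM]

/-- Intervals `[x k, M k)` in `[0, R]` that cover `[0, R)` twice and `[0, ε)` three times:
integrating `R - r` with respect to the covering number bounds the sum of the integrals of `r`
over the intervals. -/
lemma sum_sq_le_of_covering {κ : Type*} [Fintype κ] {x M : κ → ℝ} {R ε : ℝ} (hx : ∀ k, 0 ≤ x k)
    (hxM : ∀ k, x k ≤ M k) (hM : ∀ k, M k ≤ R) (hε0 : 0 ≤ ε) (hεR : ε ≤ R)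
    (h2 : ∀ r ∈ Set.Ico 0 R, 2 ≤ (Finset.univ.filter fun k => r ∈ Set.Ico (x k) (M k)).card)
    (h3 : ∀ r ∈ Set.Ico 0 ε, 3 ≤ (Finset.univ.filter fun k => r ∈ Set.Ico (x k) (M k)).card) :
    ∑ k, (M k ^ 2 - x k ^ 2) / 2 ≤
      R * ∑ k, (M k - x k) - R ^ 2 - (R * ε - ε ^ 2 / 2) := by
  have hR : 0 ≤ R := hε0.trans hεR
  have hint : ∀ y z : ℝ, IntegrableOn ((Set.Ico y z).indicator fun r => R - r) (Set.Ico 0 R) :=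
    fun y z => ((by fun_prop : Continuous fun r : ℝ => R - r).continuousOn.integrableOn_compact
      isCompact_Icc |>.mono_set Set.Ico_subset_Icc_self).indicator measurableSet_Ico
  have key : ∫ r in Set.Ico 0 R, (2 * (Set.Ico 0 R).indicator (fun r => R - r) r +
        (Set.Ico 0 ε).indicator (fun r => R - r) r) ≤
      ∫ r in Set.Ico 0 R, ∑ k, (Set.Ico (x k) (M k)).indicator (fun r => R - r) r := by
    refine setIntegral_mono_on (((hint _ _).const_mul 2).add (hint _ _))
      (integrable_finsetSum _ fun k _ => hint _ _) measurableSet_Ico fun r hr => ?_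
    have hs : ∑ k, (Set.Ico (x k) (M k)).indicator (fun r => R - r) r =
        (Finset.univ.filter fun k => r ∈ Set.Ico (x k) (M k)).card * (R - r) := by
      simp_rw [Set.indicator_apply, Finset.sum_ite, Finset.sum_const_zero, add_zero,
        Finset.sum_const, nsmul_eq_mul]
    have hRr : 0 ≤ R - r := sub_nonneg.2 hr.2.le
    rw [hs, Set.indicator_of_mem hr]
    by_cases hrε : r ∈ Set.Ico 0 ε
    · rw [Set.indicator_of_mem hrε]
      have : (3 : ℝ) ≤ ((Finset.univ.filter fun k => r ∈ Set.Ico (x k) (M k)).card : ℝ) := by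
        exact_mod_cast h3 r hrε
      nlinarith
    · rw [Set.indicator_of_notMem hrε]
      have : (2 : ℝ) ≤ ((Finset.univ.filter fun k => r ∈ Set.Ico (x k) (M k)).card : ℝ) := by
        exact_mod_cast h2 r hr
      nlinarith
  rw [integral_add ((hint _ _).const_mul 2) (hint _ _), integral_const_mul,
    setIntegral_indicator_Ico le_rfl hR le_rfl, setIntegral_indicator_Ico le_rfl hε0 hεR,
    integral_finsetSum _ fun k _ => hint _ _] at key
  simp_rw [fun k => setIntegral_indicator_Ico (hx k) (hxM k) (hM k)] at key
  rw [Finset.sum_sub_distrib, ← Finset.mul_sum] at key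
  linarith

open intervalIntegral in
/-- A function on `[0, l]` below the tent with slopes `1` and `-1` and values `a` and `b` at the
end points. The tent attains each value `r` once for every interval among
`[a, (a + b + l) / 2)` and `[b, (a + b + l) / 2)` that contains `r`. -/
lemma integral_le_tent {f : ℝ → ℝ} (hf : Continuous f) {a b l : ℝ} (hab : a ≤ b + l)
    (hba : b ≤ a + l) (h1 : ∀ t ∈ Set.Icc 0 l, f t ≤ a + t)
    (h2 : ∀ t ∈ Set.Icc 0 l, f t ≤ b + (l - t)) :
    ∫ t in (0 : ℝ)..l, f t ≤ (((a + b + l) / 2) ^ 2 - a ^ 2) / 2 +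
      (((a + b + l) / 2) ^ 2 - b ^ 2) / 2 := by
  have hm : 0 ≤ (b - a + l) / 2 := by linarith
  have hm' : (b - a + l) / 2 ≤ l := by linarith
  rw [← integral_add_adjacent_intervals (hf.intervalIntegrable 0 ((b - a + l) / 2))
    (hf.intervalIntegrable _ l)]
  refine add_le_add ?_ ?_
  · refine (integral_mono_on hm (hf.intervalIntegrable _ _)
      ((by fun_prop : Continuous fun t : ℝ => a + t).intervalIntegrable _ _)
      fun t ht => h1 t ⟨ht.1, ht.2.trans hm'⟩).trans_eq ?_
    rw [integral_comp_add_left (fun t => t), integral_id]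
    ring
  · refine (integral_mono_on hm' (hf.intervalIntegrable _ _)
      ((by fun_prop : Continuous fun t : ℝ => b + (l - t)).intervalIntegrable _ _)
      fun t ht => h2 t ⟨hm.trans ht.1, ht.2⟩).trans_eq ?_
    rw [integral_comp_sub_left (fun t => b + t), integral_comp_add_left (fun t => t), integral_id]
    ring

end Count

/-! ### The upper bound for doubly connected graphs -/

section DoublyConnected

variable {V E : Type*} {G : MetricGraph V E}

lemma JoinedIn.exists_crossing {S : Set E} {u w : V} (h : G.JoinedIn S u w) {A : Set V}
    (hu : u ∈ A) (hw : w ∉ A) : ∃ e ∈ S, ∃ x ∈ A, ∃ y ∉ A, G.ends e = s(x, y) := by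
  induction h with
  | refl => exact absurd hu hw
  | @tail b c _ hbc ih =>
    by_cases hb : b ∈ A
    · obtain ⟨e, he, hbc⟩ := hbc
      exact ⟨e, he, b, hb, c, hw, hbc⟩
    · exact ih hb

lemma DoublyConnected.exists_two_crossing (hG : G.DoublyConnected) {A : Set V} {u w : V}
    (hu : u ∈ A) (hw : w ∉ A) : ∃ e f, e ≠ f ∧ (∃ x ∈ A, ∃ y ∉ A, G.ends e = s(x, y)) ∧
      ∃ x ∈ A, ∃ y ∉ A, G.ends f = s(x, y) := by
  obtain ⟨e, -, he⟩ := (hG.1.2 u w).exists_crossing hu hw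
  have hj : G.JoinedIn {e}ᶜ u w := by
    by_contra h
    exact hG.2 e ⟨u, w, h⟩
  obtain ⟨f, hf, hf'⟩ := hj.exists_crossing hu hw
  exact ⟨e, f, fun h => hf h.symm, he, hf'⟩

/-! The point `p` with parameter `τ` on the edge `e₀` cuts this edge into two pieces. The pieces
of the graph are indexed by `Option E`: the index `none` stands for the part of `e₀` after `p`,
the index `some e₀` for the part before `p`, and the index `some f` for the edge `f` otherwise. -/

variable (G) in
/-- The distance from `p` to the first end point of a piece. -/
noncomputable def pieceIni (p : G.Point) : Option E → ℝ
  | none => 0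
  | some f => G.dist p (G.vtx (G.ini f))

open Classical in
variable (G) in
/-- The distance from `p` to the second end point of a piece. -/
noncomputable def pieceTer (e₀ : E) (p : G.Point) : Option E → ℝ
  | none => G.dist p (G.vtx (G.ter e₀))
  | some f => if f = e₀ then 0 else G.dist p (G.vtx (G.ter f))

open Classical in
variable (G) in
/-- The length of a piece. -/
noncomputable def pieceLen (e₀ : E) (τ : ℝ) : Option E → ℝ
  | none => G.len e₀ - τ
  | some f => if f = e₀ then τ else G.len f

variable (G) in
/-- The maximum of the tent function that bounds the distance from `p` on a piece. -/
noncomputable def pieceMax (e₀ : E) (τ : ℝ) (i : Option E) : ℝ :=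
  (G.pieceIni (G.pt e₀ τ) i + G.pieceTer e₀ (G.pt e₀ τ) i + G.pieceLen e₀ τ i) / 2

variable (G) in
/-- The distance from `p` to the end point of a half piece, that is, of a piece together with one
of its end points. -/
noncomputable def halfPieceDist (e₀ : E) (τ : ℝ) (k : Option E × Bool) : ℝ :=
  if k.2 then G.pieceTer e₀ (G.pt e₀ τ) k.1 else G.pieceIni (G.pt e₀ τ) k.1

lemma dist_pt_ini_le {e : E} {t : ℝ} (ht : t ∈ Set.Icc 0 (G.len e)) :
    G.dist (G.pt e t) (G.vtx (G.ini e)) ≤ t := by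
  rw [← pt_zero]
  simpa [abs_of_nonneg ht.1] using dist_pt_le e t 0

lemma dist_pt_ter_le {e : E} {t : ℝ} (ht : t ∈ Set.Icc 0 (G.len e)) :
    G.dist (G.pt e t) (G.vtx (G.ter e)) ≤ G.len e - t := by
  rw [← pt_len]
  simpa [abs_sub_comm t, abs_of_nonneg (sub_nonneg.2 ht.2)] using dist_pt_le e t (G.len e)

variable {e₀ : E} {τ : ℝ}

lemma pieceIni_nonneg (p : G.Point) (i : Option E) : 0 ≤ G.pieceIni p i := by
  cases i with
  | none => exact le_rfl
  | some f => exact dist_nonneg _ _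

lemma pieceTer_nonneg (p : G.Point) (i : Option E) : 0 ≤ G.pieceTer e₀ p i := by
  cases i with
  | none => exact dist_nonneg _ _
  | some f =>
    rw [pieceTer]
    split_ifs
    exacts [le_rfl, dist_nonneg _ _]

lemma Connected.pieceIni_le (hG : G.Connected) (hτ : τ ∈ Set.Icc 0 (G.len e₀)) (i : Option E) :
    G.pieceIni (G.pt e₀ τ) i ≤ G.pieceTer e₀ (G.pt e₀ τ) i + G.pieceLen e₀ τ i := by
  cases i with
  | none => exact add_nonneg (dist_nonneg _ _) (sub_nonneg.2 hτ.2)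
  | some f =>
    rw [pieceIni, pieceTer, pieceLen]
    split_ifs with h
    · subst h
      rw [zero_add]
      exact dist_pt_ini_le hτ
    · exact (hG.dist_triangle _ _ _).trans
        (add_le_add_right (dist_ends_le (e := f) Sym2.eq_swap) _)

lemma Connected.pieceTer_le (hG : G.Connected) (hτ : τ ∈ Set.Icc 0 (G.len e₀)) (i : Option E) :
    G.pieceTer e₀ (G.pt e₀ τ) i ≤ G.pieceIni (G.pt e₀ τ) i + G.pieceLen e₀ τ i := by
  cases i with
  | none =>
    rw [pieceIni, pieceTer, pieceLen, zero_add]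
    exact dist_pt_ter_le hτ
  | some f =>
    rw [pieceIni, pieceTer, pieceLen]
    split_ifs with h
    · exact add_nonneg (dist_nonneg _ _) hτ.1
    · exact (hG.dist_triangle _ _ _).trans (add_le_add_right (dist_ends_le (e := f) rfl) _)

lemma Connected.halfPieceDist_le_pieceMax (hG : G.Connected) (hτ : τ ∈ Set.Icc 0 (G.len e₀))
    (k : Option E × Bool) : G.halfPieceDist e₀ τ k ≤ G.pieceMax e₀ τ k.1 := by
  have h1 := hG.pieceIni_le hτ k.1
  have h2 := hG.pieceTer_le hτ k.1
  rw [halfPieceDist, pieceMax]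
  split_ifs <;> linarith

lemma halfPieceDist_nonneg (k : Option E × Bool) : 0 ≤ G.halfPieceDist e₀ τ k := by
  rw [halfPieceDist]
  split_ifs
  exacts [pieceTer_nonneg _ _, pieceIni_nonneg _ _]

lemma halfPieceDist_eq (k : Option E × Bool) :
    G.halfPieceDist e₀ τ k = 0 ∨ ∃ v, G.halfPieceDist e₀ τ k = G.dist (G.pt e₀ τ) (G.vtx v) := by
  rcases k with ⟨_ | f, _ | _⟩
  · exact .inl rfl
  · exact .inr ⟨_, rfl⟩
  · exact .inr ⟨_, rfl⟩
  · by_cases h : f = e₀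
    · exact .inl (by simp [halfPieceDist, pieceTer, h])
    · exact .inr ⟨G.ter f, by simp [halfPieceDist, pieceTer, h]⟩

/-- The integral of the distance from `p` is bounded by the integrals of the tents. -/
lemma Connected.distInt_le_sum_pieces [Fintype E] (hG : G.Connected)
    (hτ : τ ∈ Set.Icc 0 (G.len e₀)) :
    G.distInt Finset.univ (G.pt e₀ τ) ≤ ∑ k : Option E × Bool,
      (G.pieceMax e₀ τ k.1 ^ 2 - G.halfPieceDist e₀ τ k ^ 2) / 2 := by
  classical
  set p := G.pt e₀ τ with hp
  let T : Option E → ℝ := fun i => (G.pieceMax e₀ τ i ^ 2 - G.pieceIni p i ^ 2) / 2 +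
    (G.pieceMax e₀ τ i ^ 2 - G.pieceTer e₀ p i ^ 2) / 2
  have hsum : ∑ k : Option E × Bool,
      (G.pieceMax e₀ τ k.1 ^ 2 - G.halfPieceDist e₀ τ k ^ 2) / 2 = ∑ i, T i := by
    rw [Fintype.sum_prod_type]
    refine Finset.sum_congr rfl fun i _ => ?_
    simp only [Fintype.sum_bool, halfPieceDist, if_true, T]
    rw [add_comm]
    rfl
  have hini : ∀ (f : E) (t : ℝ), t ∈ Set.Icc 0 (G.len f) →
      G.dist p (G.pt f t) ≤ G.dist p (G.vtx (G.ini f)) + t := fun f t ht =>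
    (hG.dist_triangle _ (G.vtx (G.ini f)) _).trans (add_le_add_right
      ((dist_comm _ _).trans_le (dist_pt_ini_le ht)) _)
  have hter : ∀ (f : E) (t : ℝ), t ∈ Set.Icc 0 (G.len f) →
      G.dist p (G.pt f t) ≤ G.dist p (G.vtx (G.ter f)) + (G.len f - t) := fun f t ht =>
    (hG.dist_triangle _ (G.vtx (G.ter f)) _).trans (add_le_add_right
      ((dist_comm _ _).trans_le (dist_pt_ter_le ht)) _)
  have hle : ∀ f, ∫ t in 0..G.len f, G.dist p (G.pt f t) ≤
      T (some f) + if f = e₀ then T none else 0 := by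
    intro f
    have hc := hG.continuous_dist_pt_right p f
    have h1 := hG.pieceIni_le hτ (some f)
    have h2 := hG.pieceTer_le hτ (some f)
    split_ifs with hf
    · subst hf
      have h3 := hG.pieceIni_le hτ none
      have h4 := hG.pieceTer_le hτ none
      rw [← intervalIntegral.integral_add_adjacent_intervals (hc.intervalIntegrable 0 τ)
        (hc.intervalIntegrable τ _)]
      refine add_le_add ?_ ?_
      · simp only [pieceIni, pieceTer, pieceLen, if_true] at h1 h2
        simp only [T, pieceMax, pieceIni, pieceTer, pieceLen, if_true]
        refine integral_le_tent hc h1 h2 (fun t ht => hini f t ⟨ht.1, ht.2.trans hτ.2⟩)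
          fun t ht => ?_
        rw [zero_add, ← abs_of_nonneg (sub_nonneg.2 ht.2)]
        exact dist_pt_le _ _ _
      · have hs := intervalIntegral.integral_comp_add_left (a := 0) (b := G.len f - τ)
          (fun t => G.dist p (G.pt f t)) τ
        rw [add_zero, add_sub_cancel] at hs
        rw [← hs]
        simp only [pieceIni, pieceTer, pieceLen] at h3 h4
        simp only [T, pieceMax, pieceIni, pieceTer, pieceLen]
        refine integral_le_tent (f := fun t => G.dist p (G.pt f (τ + t)))
          (hc.comp (continuous_const.add continuous_id)) h3 h4 (fun t ht => ?_) fun t ht => ?_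
        · refine (dist_pt_le _ _ _).trans_eq ?_
          rw [sub_add_cancel_left, abs_neg, abs_of_nonneg ht.1, zero_add]
        · refine (hter f _ ⟨add_nonneg hτ.1 ht.1, by linarith [ht.2]⟩).trans_eq ?_
          ring
    · simp only [pieceIni, pieceTer, pieceLen, if_neg hf] at h1 h2
      simp only [T, pieceMax, pieceIni, pieceTer, pieceLen, if_neg hf, add_zero]
      exact integral_le_tent hc h1 h2 (hini f) (hter f)
  rw [hsum, Fintype.sum_option, distInt]
  refine (Finset.sum_le_sum fun f _ => hle f).trans_eq ?_
  rw [Finset.sum_add_distrib, Finset.sum_ite_eq' Finset.univ e₀ fun _ => T none,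
    if_pos (Finset.mem_univ _), add_comm]

lemma sum_pieceMax_sub [Fintype E] :
    ∑ k : Option E × Bool, (G.pieceMax e₀ τ k.1 - G.halfPieceDist e₀ τ k) =
      G.length Finset.univ := by
  classical
  have h1 : ∀ i, ∑ b : Bool, (G.pieceMax e₀ τ i - G.halfPieceDist e₀ τ (i, b)) =
      G.pieceLen e₀ τ i := fun i => by
    simp only [Fintype.sum_bool, halfPieceDist, if_true, pieceMax]
    norm_num
    ring
  have h2 : ∀ f, G.pieceLen e₀ τ (some f) = G.len f - if f = e₀ then G.len e₀ - τ else 0 := by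
    intro f
    rw [pieceLen]
    split_ifs with h
    · rw [h]; ring
    · ring
  rw [Fintype.sum_prod_type]
  simp_rw [h1]
  rw [Fintype.sum_option]
  simp_rw [h2]
  rw [Finset.sum_sub_distrib, Finset.sum_ite_eq' Finset.univ e₀ fun _ => G.len e₀ - τ,
    if_pos (Finset.mem_univ _), length, pieceLen]
  ring

/-- An edge that leads from a vertex at distance at most `r` from `p` to a vertex at distance more
than `r` contains a half piece on which the distance `r` is attained. -/
lemma Connected.exists_halfPiece_of_crossing (hG : G.Connected)
    (hτ : τ ∈ Set.Icc 0 (G.len e₀)) {r : ℝ} (hr : 0 ≤ r) {f : E} {x y : V}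
    (hf : G.ends f = s(x, y)) (hx : G.dist (G.pt e₀ τ) (G.vtx x) ≤ r)
    (hy : r < G.dist (G.pt e₀ τ) (G.vtx y)) :
    ∃ k : Option E × Bool, k.1.getD e₀ = f ∧
      r ∈ Set.Ico (G.halfPieceDist e₀ τ k) (G.pieceMax e₀ τ k.1) := by
  have hM : ∀ i b, G.halfPieceDist e₀ τ (i, b) ≤ G.pieceMax e₀ τ i := fun i b =>
    hG.halfPieceDist_le_pieceMax hτ (i, b)
  by_cases h0 : f = e₀
  · subst h0
    rcases Sym2.eq_iff.1 hf with ⟨rfl, rfl⟩ | ⟨rfl, rfl⟩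
    · exact ⟨(none, false), rfl, hr, hy.trans_le (hM none true)⟩
    · refine ⟨(some f, true), rfl, ?_, hy.trans_le (hM (some f) false)⟩
      simpa [halfPieceDist, pieceTer] using hr
  · have ht : G.halfPieceDist e₀ τ (some f, true) = G.dist (G.pt e₀ τ) (G.vtx (G.ter f)) := by
      simp [halfPieceDist, pieceTer, h0]
    rcases Sym2.eq_iff.1 hf with ⟨rfl, rfl⟩ | ⟨rfl, rfl⟩
    · exact ⟨(some f, false), rfl, hx, (hy.trans_eq ht.symm).trans_le (hM (some f) true)⟩
    · exact ⟨(some f, true), rfl, ht.trans_le hx, hy.trans_le (hM (some f) false)⟩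

/-- In a doubly connected graph, every distance below the maximum is attained at least twice. -/
lemma DoublyConnected.two_le_card [Fintype E] (hG : G.DoublyConnected)
    (hτ : τ ∈ Set.Icc 0 (G.len e₀)) (i₀ : Option E) {r : ℝ} (hr0 : 0 ≤ r)
    (hr : r < G.pieceMax e₀ τ i₀) :
    2 ≤ (Finset.univ.filter fun k : Option E × Bool =>
      r ∈ Set.Ico (G.halfPieceDist e₀ τ k) (G.pieceMax e₀ τ k.1)).card := by
  have hM : ∀ i b, G.halfPieceDist e₀ τ (i, b) ≤ G.pieceMax e₀ τ i := fun i b =>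
    hG.1.halfPieceDist_le_pieceMax hτ (i, b)
  suffices h : ∃ k l : Option E × Bool, k ≠ l ∧
      r ∈ Set.Ico (G.halfPieceDist e₀ τ k) (G.pieceMax e₀ τ k.1) ∧
      r ∈ Set.Ico (G.halfPieceDist e₀ τ l) (G.pieceMax e₀ τ l.1) by
    obtain ⟨k, l, hkl, hk, hl⟩ := h
    exact Finset.one_lt_card.2 ⟨k, by simpa using hk, l, by simpa using hl, hkl⟩
  by_cases hA : ∃ u, G.dist (G.pt e₀ τ) (G.vtx u) ≤ r
  · obtain ⟨u, hu⟩ := hA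
    by_cases hB : ∃ w, r < G.dist (G.pt e₀ τ) (G.vtx w)
    · -- Two edges lead from the vertices at distance at most `r` to the other ones.
      obtain ⟨w, hw⟩ := hB
      obtain ⟨e, f, hef, ⟨x, hx, y, hy, he⟩, x', hx', y', hy', hf⟩ :=
        hG.exists_two_crossing (A := {v | G.dist (G.pt e₀ τ) (G.vtx v) ≤ r}) hu (not_le.2 hw)
      obtain ⟨k, hk, hk'⟩ := hG.1.exists_halfPiece_of_crossing hτ hr0 he hx (not_le.1 hy)
      obtain ⟨l, hl, hl'⟩ := hG.1.exists_halfPiece_of_crossing hτ hr0 hf hx' (not_le.1 hy')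
      exact ⟨k, l, fun hkl => hef (by rw [← hk, ← hl, hkl]), hk', hl'⟩
    · -- The distance is at most `r` at all vertices, and larger somewhere on the piece `i₀`.
      push Not at hB
      have hB' : ∀ k, G.halfPieceDist e₀ τ k ≤ r := fun k => by
        rcases halfPieceDist_eq (G := G) (e₀ := e₀) (τ := τ) k with h | ⟨v, h⟩
        exacts [h.trans_le hr0, h.trans_le (hB v)]
      exact ⟨(i₀, false), (i₀, true), by simp, ⟨hB' _, hr⟩, ⟨hB' _, hr⟩⟩
  · -- The distance is larger than `r` at both ends of the edge that contains `p`.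
    push Not at hA
    refine ⟨(none, false), (some e₀, true), by simp,
      ⟨hr0, (hA (G.ter e₀)).trans_le (hM none true)⟩, ?_,
      (hA (G.ini e₀)).trans_le (hM (some e₀) false)⟩
    simpa [halfPieceDist, pieceTer] using hr0

lemma DoublyConnected.exists_radius [Fintype E] (hG : G.DoublyConnected)
    (hτ : τ ∈ Set.Icc 0 (G.len e₀)) : ∃ R, (∀ i, G.pieceMax e₀ τ i ≤ R) ∧ 0 ≤ R ∧
      ∀ ε, 0 ≤ ε → ε ≤ R → (∀ r ∈ Set.Ico 0 ε,
        3 ≤ (Finset.univ.filter fun k : Option E × Bool =>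
          r ∈ Set.Ico (G.halfPieceDist e₀ τ k) (G.pieceMax e₀ τ k.1)).card) →
      G.distInt Finset.univ (G.pt e₀ τ) ≤
        R * G.length Finset.univ - R ^ 2 - (R * ε - ε ^ 2 / 2) := by
  obtain ⟨i₀, hi₀⟩ := Finite.exists_max (G.pieceMax e₀ τ)
  refine ⟨_, hi₀, (halfPieceDist_nonneg (i₀, false)).trans
    (hG.1.halfPieceDist_le_pieceMax hτ (i₀, false)), fun ε hε hεR h3 => ?_⟩
  refine (hG.1.distInt_le_sum_pieces hτ).trans ?_
  rw [← sum_pieceMax_sub (e₀ := e₀) (τ := τ)]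
  exact sum_sq_le_of_covering halfPieceDist_nonneg (hG.1.halfPieceDist_le_pieceMax hτ)
    (fun k => hi₀ k.1) hε hεR (fun r hr => hG.two_le_card hτ i₀ hr.1 hr.2) h3

theorem DoublyConnected.distInt_le [Fintype E] (hG : G.DoublyConnected)
    (hτ : τ ∈ Set.Icc 0 (G.len e₀)) :
    G.distInt Finset.univ (G.pt e₀ τ) ≤ G.length Finset.univ ^ 2 / 4 := by
  obtain ⟨R, -, hR, h⟩ := hG.exists_radius hτ
  have := h 0 le_rfl hR (by simp)
  nlinarith [sq_nonneg (R - G.length Finset.univ / 2)]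

variable (G) in
/-- The end vertex of an edge at the side given by a Boolean. -/
def sideEnd (j : E × Bool) : V := if j.2 then G.ter j.1 else G.ini j.1

/-- If the edges arrive at a vertex from three sides, then small distances from this vertex are
attained three times, and the mean distance from it is not maximal. -/
theorem DoublyConnected.distInt_lt [Fintype E] (hG : G.DoublyConnected) {v : V}
    (j : Fin 3 → E × Bool) (hj : Function.Injective j) (hjv : ∀ a, G.sideEnd (j a) = v) :
    G.distInt Finset.univ (G.vtx v) < G.length Finset.univ ^ 2 / 4 := by
  classical
  -- The vertex is an end point of the edge `e₀`, whose only nontrivial piece has index `c`.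
  obtain ⟨e₀, τ, c, hτ, hv, hc⟩ : ∃ (e₀ : E) (τ : ℝ) (c : Option E), τ ∈ Set.Icc 0 (G.len e₀) ∧
      G.vtx v = G.pt e₀ τ ∧ (c = none ∧ τ = 0 ∨ c = some e₀ ∧ τ = G.len e₀) := by
    have h0 := hjv 0
    rw [sideEnd] at h0
    have hl := (G.len_pos (j 0).1).le
    split_ifs at h0
    · exact ⟨(j 0).1, _, _, ⟨hl, le_rfl⟩, by rw [pt_len, h0], .inr ⟨rfl, rfl⟩⟩
    · exact ⟨(j 0).1, _, _, ⟨le_rfl, hl⟩, by rw [pt_zero, h0], .inl ⟨rfl, rfl⟩⟩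
  have hdv : G.dist (G.pt e₀ τ) (G.vtx v) = 0 := by rw [hv, dist_self]
  let σ : E × Bool → Option E × Bool := fun k => (if k.1 = e₀ then c else some k.1, k.2)
  have hσ : Function.Injective σ := by
    rintro ⟨f, b⟩ ⟨f', b'⟩ h
    obtain ⟨h1, h2⟩ := Prod.mk.inj h
    simp only at h1 h2
    subst h2
    have : f = f' := by
      split_ifs at h1 with h3 h4 h4
      · rw [h3, h4]
      · rcases hc with ⟨rfl, -⟩ | ⟨rfl, -⟩
        · simp at h1
        · exact h3.trans (Option.some_injective _ h1)
      · rcases hc with ⟨rfl, -⟩ | ⟨rfl, -⟩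
        · simp at h1
        · exact (Option.some_injective _ h1).trans h4.symm
      · exact Option.some_injective _ h1
    rw [this]
  have hzero : ∀ a, G.halfPieceDist e₀ τ (σ (j a)) = 0 := by
    intro a
    have ha := hjv a
    rcases hja : j a with ⟨f, b⟩
    rw [hja] at ha
    by_cases hf : f = e₀
    · subst hf
      rcases hc with ⟨rfl, -⟩ | ⟨rfl, -⟩ <;> cases b <;>
        simp_all [σ, halfPieceDist, pieceIni, pieceTer, sideEnd]
    · cases b <;> simp_all [σ, halfPieceDist, pieceIni, pieceTer, sideEnd]
  have hlen : ∀ k, 0 < G.pieceLen e₀ τ (σ k).1 := by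
    rintro ⟨f, b⟩
    have := G.len_pos f
    by_cases hf : f = e₀
    · subst hf
      rcases hc with ⟨rfl, rfl⟩ | ⟨rfl, rfl⟩ <;> simpa [σ, pieceLen] using this
    · simpa [σ, pieceLen, hf] using this
  have hMpos : ∀ k, 0 < G.pieceMax e₀ τ (σ k).1 := fun k => by
    have h1 := pieceIni_nonneg (G.pt e₀ τ) (σ k).1
    have h2 := pieceTer_nonneg (e₀ := e₀) (G.pt e₀ τ) (σ k).1
    have h3 := hlen k
    rw [pieceMax]
    linarith
  obtain ⟨a₀, ha₀⟩ := Finite.exists_min fun a => G.pieceMax e₀ τ (σ (j a)).1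
  obtain ⟨R, hMR, hR, h⟩ := hG.exists_radius hτ
  have hε := hMpos (j a₀)
  have hεR := hMR (σ (j a₀)).1
  have := h _ hε.le hεR fun r hr => by
    have := Finset.card_le_card_of_injOn (s := (Finset.univ : Finset (Fin 3)))
      (t := Finset.univ.filter fun k : Option E × Bool =>
        r ∈ Set.Ico (G.halfPieceDist e₀ τ k) (G.pieceMax e₀ τ k.1)) (fun a => σ (j a))
      (fun a _ => by
        simp only [Finset.coe_filter, Finset.mem_univ, true_and, Set.mem_ofPred_eq]
        exact ⟨(hzero a).trans_le hr.1, hr.2.trans_le (ha₀ a)⟩)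
      fun a _ b _ hab => hj (hσ hab)
    simpa using this
  rw [hv]
  nlinarith [sq_nonneg (R - G.length Finset.univ / 2), mul_pos hε hε,
    mul_le_mul_of_nonneg_right hεR hε.le]

end DoublyConnected

/-! ### Doubly connected graphs of maximal mean distance -/

section Loop

open intervalIntegral

variable {V E : Type*} {G : MetricGraph V E}

lemma DoublyConnected.integral_distInt_le [Fintype E] (hG : G.DoublyConnected) (e : E) :
    ∫ s in 0..G.len e, G.distInt Finset.univ (G.pt e s) ≤
      ∫ _ in 0..G.len e, G.length Finset.univ ^ 2 / 4 :=
  integral_mono_on (G.len_pos e).le ((hG.1.continuous_distInt _ e).intervalIntegrable _ _)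
    (continuous_const.intervalIntegrable _ _) fun _ hs => hG.distInt_le hs

lemma sum_integral_const [Fintype E] (c : ℝ) :
    ∑ e, ∫ _ in 0..G.len e, c = G.length Finset.univ * c := by
  simp [length, Finset.sum_mul]

theorem DoublyConnected.distInt₂_le [Fintype E] (hG : G.DoublyConnected) :
    G.distInt₂ Finset.univ ≤ G.length Finset.univ ^ 3 / 4 := by
  refine (Finset.sum_le_sum fun e _ => hG.integral_distInt_le e).trans_eq ?_
  rw [sum_integral_const]
  ring

lemma DoublyConnected.distInt_eq [Fintype E] (hG : G.DoublyConnected)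
    (hF : G.distInt₂ Finset.univ = G.length Finset.univ ^ 3 / 4) (j : E × Bool) :
    G.distInt Finset.univ (G.vtx (G.sideEnd j)) = G.length Finset.univ ^ 2 / 4 := by
  obtain ⟨e, b⟩ := j
  have hl := G.len_pos e
  have h1 : G.distInt₂ Finset.univ = ∑ e, ∫ _ in 0..G.len e, G.length Finset.univ ^ 2 / 4 := by
    rw [hF, sum_integral_const]
    ring
  have h2 := (Finset.sum_eq_sum_iff_of_le fun e _ => hG.integral_distInt_le e).1 h1 e
    (Finset.mem_univ e)
  have h3 := eqOn_of_integral_eq hl (hG.1.continuous_distInt Finset.univ e) continuous_const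
    (fun s hs => hG.distInt_le hs) h2.ge
  cases b
  · have := h3 0 ⟨le_rfl, hl.le⟩
    rwa [pt_zero] at this
  · have := h3 _ ⟨hl.le, le_rfl⟩
    rwa [pt_len] at this

lemma exists_sideEnd_eq {e : E} {v w : V} (h : G.ends e = s(v, w)) :
    ∃ b, G.sideEnd (e, b) = v := by
  rcases Sym2.eq_iff.1 h with ⟨h, -⟩ | ⟨-, h⟩
  exacts [⟨false, h⟩, ⟨true, h⟩]

variable {n : ℕ} {v : ℕ → V} {e : ℕ → E}

/-- If no three sides of edges meet at a vertex, then there are no three edges at a vertex. -/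
lemma eq_or_eq_of_ends (hdeg : ∀ (v : V) (j : Fin 3 → E × Bool), Function.Injective j →
    ¬ ∀ a, G.sideEnd (j a) = v) {u w₁ w₂ w₃ : V} {e₁ e₂ e₃ : E} (h₁ : G.ends e₁ = s(u, w₁))
    (h₂ : G.ends e₂ = s(u, w₂)) (h₃ : G.ends e₃ = s(u, w₃)) (h₁₂ : e₁ ≠ e₂) :
    e₃ = e₁ ∨ e₃ = e₂ := by
  by_contra! h
  obtain ⟨b₁, hb₁⟩ := exists_sideEnd_eq h₁
  obtain ⟨b₂, hb₂⟩ := exists_sideEnd_eq h₂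
  obtain ⟨b₃, hb₃⟩ := exists_sideEnd_eq h₃
  refine hdeg u ![(e₁, b₁), (e₂, b₂), (e₃, b₃)] ?_ ?_
  · intro a b hab
    have h1 := h.1.symm
    have h2 := h.2.symm
    fin_cases a <;> fin_cases b <;> simp_all
  · intro a
    fin_cases a
    exacts [hb₁, hb₂, hb₃]

/-- If no three sides of edges meet at a vertex and every simple path is trivial, then the graph is
a single loop at a single vertex. -/
lemma IsLongestPath.isLoop_of_eq_zero [Nonempty E] (hG : G.Connected)
    (hdeg : ∀ (v : V) (j : Fin 3 → E × Bool), Function.Injective j → ¬ ∀ a, G.sideEnd (j a) = v)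
    (h : G.IsLongestPath 0 v e) : G.IsLoop := by
  have hW := hG.eq_univ_of_closed (W := {v 0}) ⟨_, rfl⟩ fun f => by
    constructor
    · intro (hf : G.ini f = v 0)
      obtain ⟨i, hi, hi'⟩ := h.exists_eq (f := f) (w := G.ter f) (by rw [← hf]; rfl)
      rw [Nat.le_zero.1 hi] at hi'
      exact hi'.symm
    · intro (hf : G.ter f = v 0)
      obtain ⟨i, hi, hi'⟩ := h.exists_eq (f := f) (w := G.ini f) (by rw [← hf]; exact Sym2.eq_swap)
      rw [Nat.le_zero.1 hi] at hi'
      exact hi'.symm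
  have hV : ∀ x, x = v 0 := fun x => hW.ge (Set.mem_univ x)
  have hE : ∀ f g : E, f = g := by
    intro f g
    by_contra hfg
    refine hdeg (v 0) ![(f, true), (f, false), (g, true)] ?_ fun _ => hV _
    intro a b hab
    have := Ne.symm hfg
    fin_cases a <;> fin_cases b <;> simp_all
  have : Subsingleton V := ⟨fun x y => (hV x).trans (hV y).symm⟩
  have : Subsingleton E := ⟨hE⟩
  have : Subsingleton (Fin (0 + 1)) := inferInstanceAs (Subsingleton (Fin 1))
  exact ⟨0, Equiv.ofBijective (fun _ => v 0) ⟨fun _ _ _ => Subsingleton.elim _ _,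
    fun x => ⟨0, (hV x).symm⟩⟩, Equiv.ofBijective (fun _ => Classical.arbitrary E)
    ⟨fun _ _ _ => Subsingleton.elim _ _, fun f => ⟨0, hE _ f⟩⟩,
    fun i => congrArg₂ (fun x y => s(x, y)) (Subsingleton.elim _ _) (Subsingleton.elim _ _)⟩

/-- If no three sides of edges meet at a vertex, then a longest path closes up to a loop, which is
the whole graph. -/
lemma IsLongestPath.isLoop [Nonempty E] (hG : G.DoublyConnected)
    (hdeg : ∀ (v : V) (j : Fin 3 → E × Bool), Function.Injective j → ¬ ∀ a, G.sideEnd (j a) = v)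
    (h : G.IsLongestPath n v e) : G.IsLoop := by
  rcases Nat.eq_zero_or_pos n with rfl | hn
  · exact h.isLoop_of_eq_zero hG.1 hdeg
  have hinj := h.1.1
  have hends := h.1.2
  have hends' : ∀ i < n, G.ends (e i) = s(v (i + 1), v i) := fun i hi =>
    (hends i hi).trans Sym2.eq_swap
  -- An edge `f` outside the path leaves its last vertex, since there are no bridges.
  obtain ⟨f, hf, w, hw, hfw⟩ : ∃ f, f ≠ e (n - 1) ∧ ∃ w, w ≠ v n ∧ G.ends f = s(v n, w) := by
    obtain ⟨f, g, hfg, ⟨_, rfl, y, hy, hf⟩, _, rfl, y', hy', hg⟩ :=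
      hG.exists_two_crossing (A := {v n}) (u := v n) (w := v 0) rfl
        fun h0 => hn.ne (hinj 0 (Nat.zero_le n) n le_rfl h0)
    by_cases hf' : f = e (n - 1)
    · exact ⟨g, fun hg' => hfg (hf'.trans hg'.symm), y', hy', hg⟩
    · exact ⟨f, hf', y, hy, hf⟩
  obtain ⟨k, hk, rfl⟩ := h.exists_eq hfw
  have hkn : k < n := lt_of_le_of_ne hk fun hkn => hw (by rw [hkn])
  have hfe : ∀ i < n, f ≠ e i := by
    rintro i hi rfl
    rcases Sym2.eq_iff.1 ((hends i hi).symm.trans hfw) with ⟨h1, -⟩ | ⟨-, h1⟩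
    · have := hinj i hi.le n le_rfl h1
      omega
    · have := hinj (i + 1) hi n le_rfl h1
      exact hf (by rw [← this, Nat.add_sub_cancel])
  -- It leads to the first vertex: there are two edges of the path at each inner vertex.
  obtain rfl : k = 0 := by
    by_contra hk0
    have h1 := hends' (k - 1) (by omega)
    rw [Nat.sub_add_cancel (Nat.pos_of_ne_zero hk0)] at h1
    rcases eq_or_eq_of_ends hdeg h1 (hends k hkn) (hfw.trans Sym2.eq_swap)
      (fun h2 => by have := h.1.edge_injOn (by omega) hkn h2; omega) with h2 | h2
    · exact hfe _ (by omega) h2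
    · exact hfe _ hkn h2
  have htouch : ∀ i ≤ n, ∀ g x, G.ends g = s(v i, x) → g = f ∨ ∃ k < n, g = e k := by
    intro i hi g x hg
    rcases Nat.eq_zero_or_pos i with rfl | hi0
    · rcases eq_or_eq_of_ends hdeg (hends 0 hn) (hfw.trans Sym2.eq_swap) hg (hfe 0 hn).symm
        with h1 | h1
      exacts [.inr ⟨0, hn, h1⟩, .inl h1]
    · have h1 := hends' (i - 1) (by omega)
      rw [Nat.sub_add_cancel hi0] at h1
      rcases hi.lt_or_eq with hi | rfl
      · rcases eq_or_eq_of_ends hdeg h1 (hends i hi) hg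
          (fun h2 => by have := h.1.edge_injOn (by omega) hi h2; omega) with h2 | h2
        exacts [.inr ⟨_, by omega, h2⟩, .inr ⟨i, hi, h2⟩]
      · rcases eq_or_eq_of_ends hdeg h1 hfw hg (hfe _ (by omega)).symm with h2 | h2
        exacts [.inr ⟨_, by omega, h2⟩, .inl h2]
  have hmem : ∀ g, (g = f ∨ ∃ k < n, g = e k) →
      G.ini g ∈ v '' Set.Iic n ∧ G.ter g ∈ v '' Set.Iic n := by
    have hsub : ∀ g, ∀ i ≤ n, ∀ j ≤ n, G.ends g = s(v i, v j) →
        G.ini g ∈ v '' Set.Iic n ∧ G.ter g ∈ v '' Set.Iic n := by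
      intro g i hi j hj hg
      rcases Sym2.eq_iff.1 hg with ⟨h1, h2⟩ | ⟨h1, h2⟩ <;> rw [h1, h2]
      exacts [⟨⟨i, hi, rfl⟩, j, hj, rfl⟩, ⟨⟨j, hj, rfl⟩, i, hi, rfl⟩]
    rintro g (rfl | ⟨k, hk, rfl⟩)
    exacts [hsub g n le_rfl 0 (Nat.zero_le n) hfw, hsub _ k hk.le (k + 1) hk (hends k hk)]
  have htouch' : ∀ g, G.ini g ∈ v '' Set.Iic n ∨ G.ter g ∈ v '' Set.Iic n →
      g = f ∨ ∃ k < n, g = e k := by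
    rintro g (⟨i, hi, h1⟩ | ⟨i, hi, h1⟩)
    · exact htouch i hi g (G.ter g) (by rw [h1]; rfl)
    · exact htouch i hi g (G.ini g) (by rw [h1]; exact Sym2.eq_swap)
  have hW := hG.1.eq_univ_of_closed (W := v '' Set.Iic n) ⟨v 0, 0, Nat.zero_le n, rfl⟩ fun g =>
    ⟨fun hg => (hmem g (htouch' g (.inl hg))).2, fun hg => (hmem g (htouch' g (.inr hg))).1⟩
  refine ⟨n, Equiv.ofBijective (fun i => v i) ⟨fun i j hij => ?_, fun x => ?_⟩,
    Equiv.ofBijective (fun i => if (i : ℕ) < n then e i else f) ⟨fun i j hij => ?_, fun g => ?_⟩,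
    fun i => ?_⟩
  · exact Fin.ext (hinj i (Nat.lt_succ_iff.1 i.2) j (Nat.lt_succ_iff.1 j.2) hij)
  · obtain ⟨i, hi, rfl⟩ := hW.ge (Set.mem_univ x)
    exact ⟨⟨i, Nat.lt_succ_iff.2 hi⟩, rfl⟩
  · dsimp only at hij
    split_ifs at hij with h1 h2 h2
    · exact Fin.ext (h.1.edge_injOn h1 h2 hij)
    · exact absurd hij.symm (hfe _ h1)
    · exact absurd hij (hfe _ h2)
    · exact Fin.ext (by omega)
  · rcases htouch' g (.inl (hW.ge (Set.mem_univ _))) with rfl | ⟨k, hk, rfl⟩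
    · exact ⟨Fin.last n, by simp⟩
    · exact ⟨⟨k, by omega⟩, by simp [hk]⟩
  · rcases Fin.eq_castSucc_or_eq_last i with ⟨j, rfl⟩ | rfl
    · change G.ends (if (j : ℕ) < n then e j else f) = s(v j, v (j.castSucc + 1 : Fin (n + 1)))
      rw [if_pos j.2, Fin.coeSucc_eq_succ, hends j j.2]
      rfl
    · change G.ends (if n < n then e n else f) = s(v n, v (Fin.last n + 1 : Fin (n + 1)))
      rw [if_neg (lt_irrefl n), Fin.last_add_one, hfw]
      rfl

theorem DoublyConnected.isLoop_of_distInt₂_eq [Fintype V] [Fintype E] [Nonempty E]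
    (hG : G.DoublyConnected) (hF : G.distInt₂ Finset.univ = G.length Finset.univ ^ 3 / 4) :
    G.IsLoop := by
  have := hG.1.1
  obtain ⟨n, v, e, h⟩ := exists_isLongestPath (G := G)
  refine h.isLoop hG fun v j hj hjv => ?_
  have h1 := hG.distInt_lt j hj hjv
  rw [← hjv 0, hG.distInt_eq hF] at h1
  exact lt_irrefl _ h1

end Loop

/-! ### The lower bound -/

section Flower

open intervalIntegral

variable {V E : Type*} {G : MetricGraph V E}

/-- A cubic polynomial in several variables with given sum is minimal if they are equal. -/
lemma cubic_lower_bound {ι : Type*} [Fintype ι] (x : ι → ℝ) (hx : ∀ i, 0 < x i) (L : ℝ)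
    (hL : ∑ i, x i = L) (hL0 : 0 < L) :
    (2 * (Fintype.card ι : ℝ) - 1) / (Fintype.card ι : ℝ) ^ 2 * L ^ 3 ≤
        2 * L * ∑ i, x i ^ 2 - ∑ i, x i ^ 3 ∧
      (2 * L * ∑ i, x i ^ 2 - ∑ i, x i ^ 3 =
        (2 * (Fintype.card ι : ℝ) - 1) / (Fintype.card ι : ℝ) ^ 2 * L ^ 3 ↔
          ∀ i j, x i = x j) := by
  have hne : Nonempty ι := by
    by_contra h
    rw [not_nonempty_iff] at h
    simp at hL
    linarith
  have hN : (0 : ℝ) < Fintype.card ι := by exact_mod_cast Fintype.card_pos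
  obtain ⟨a, ha⟩ : ∃ a, a = L / Fintype.card ι := ⟨_, rfl⟩
  have haN : (Fintype.card ι : ℝ) * a = L := by rw [ha]; field_simp
  -- Expand the polynomial at the mean value `a`.
  have hexp : 2 * L * ∑ i, x i ^ 2 - ∑ i, x i ^ 3 =
      (2 * (Fintype.card ι : ℝ) - 1) / (Fintype.card ι : ℝ) ^ 2 * L ^ 3 +
        ∑ i, (x i - a) ^ 2 * (2 * L - x i - 2 * a) := by
    have h1 : ∀ i, (x i - a) ^ 2 * (2 * L - x i - 2 * a) =
        2 * L * x i ^ 2 - x i ^ 3 - (2 * L * a ^ 2 - a ^ 3)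
          - (4 * L * a - 3 * a ^ 2) * (x i - a) := fun i => by ring
    have h2 : ∑ i, (x i - a) = 0 := by
      rw [Finset.sum_sub_distrib, hL, Finset.sum_const, Finset.card_univ, nsmul_eq_mul, haN,
        sub_self]
    have h3 : (Fintype.card ι : ℝ) * (2 * L * a ^ 2 - a ^ 3) =
        (2 * (Fintype.card ι : ℝ) - 1) / (Fintype.card ι : ℝ) ^ 2 * L ^ 3 := by
      rw [ha]
      field_simp
    simp_rw [h1, Finset.sum_sub_distrib]
    simp only [← Finset.mul_sum, h2, Finset.sum_const, Finset.card_univ, nsmul_eq_mul]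
    linear_combination h3
  have hterm : ∀ i, 0 ≤ (x i - a) ^ 2 * (2 * L - x i - 2 * a) ∧
      ((x i - a) ^ 2 * (2 * L - x i - 2 * a) = 0 → x i = a) := by
    intro i
    rcases subsingleton_or_nontrivial ι with hs | hs
    · have h1 : x i = a := by
        rw [ha, ← hL, Fintype.sum_subsingleton _ i, Fintype.card_eq_one_iff.2
          ⟨i, fun j => Subsingleton.elim _ _⟩]
        simp
      simp [h1]
    · obtain ⟨j, hj⟩ := exists_ne i
      have h1 : x i < L := by
        rw [← hL]
        exact Finset.single_lt_sum hj (Finset.mem_univ i) (Finset.mem_univ j) (hx j)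
          fun k _ _ => (hx k).le
      have h2 : (2 : ℝ) ≤ Fintype.card ι := by
        exact_mod_cast Fintype.one_lt_card
      have h3 : 0 < a := by rw [ha]; positivity
      have h4 : 0 < 2 * L - x i - 2 * a := by nlinarith
      refine ⟨by positivity, fun h => ?_⟩
      have := (mul_eq_zero.1 h).resolve_right h4.ne'
      exact sub_eq_zero.1 (pow_eq_zero_iff two_ne_zero |>.1 this)
  refine ⟨?_, fun h i j => ?_, fun h => ?_⟩
  · rw [hexp]
    linarith [Finset.sum_nonneg fun i (_ : i ∈ Finset.univ) => (hterm i).1]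
  · have h0 : ∑ i, (x i - a) ^ 2 * (2 * L - x i - 2 * a) = 0 := by linarith
    have h1 := (Finset.sum_eq_zero_iff_of_nonneg fun i _ => (hterm i).1).1 h0
    rw [(hterm i).2 (h1 i (Finset.mem_univ i)), (hterm j).2 (h1 j (Finset.mem_univ j))]
  · have h1 : ∀ i, x i = a := fun i => by
      rw [ha, ← hL, Finset.sum_congr rfl fun j _ => h j i, Finset.sum_const, Finset.card_univ,
        nsmul_eq_mul]
      field_simp
    rw [hexp]
    simp [h1]

lemma min_le_norm_addCircle {l x : ℝ} (hx : |x| ≤ l) :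
    min |x| (l - |x|) ≤ ‖(x : AddCircle l)‖ := by
  rw [AddCircle.norm_eq]
  by_cases h0 : round (l⁻¹ * x) = 0
  · simp [h0]
  · refine (min_le_right _ _).trans ?_
    have h1 : (1 : ℝ) ≤ |(round (l⁻¹ * x) : ℝ)| := by exact_mod_cast Int.one_le_abs h0
    have h2 := abs_sub_abs_le_abs_sub ((round (l⁻¹ * x) : ℝ) * l) x
    have hl : 0 ≤ l := (abs_nonneg x).trans hx
    rw [abs_mul, abs_of_nonneg hl, abs_sub_comm] at h2
    nlinarith

lemma abs_norm_sub_norm_addCircle_le {l s t : ℝ} :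
    |‖(s : AddCircle l)‖ - ‖(t : AddCircle l)‖| ≤ |s - t| := by
  refine (abs_norm_sub_norm_le _ _).trans ?_
  rw [← AddCircle.coe_sub]
  exact QuotientAddGroup.norm_mk_le_norm

lemma norm_addCircle_period_sub {l s : ℝ} :
    ‖((l - s : ℝ) : AddCircle l)‖ = ‖(s : AddCircle l)‖ := by
  rw [AddCircle.coe_sub, AddCircle.coe_period, zero_sub, norm_neg]

lemma continuous_norm_addCircle {l s : ℝ} :
    Continuous fun t : ℝ => ‖((t - s : ℝ) : AddCircle l)‖ :=
  ((AddCircle.continuous_mk' l).comp (continuous_id.sub continuous_const)).norm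

open Classical in
variable (G) in
/-- The distance between two points after all vertices have been glued together. -/
noncomputable def flowerDist (e : E) (s : ℝ) (f : E) (t : ℝ) : ℝ :=
  if f = e then ‖((t - s : ℝ) : AddCircle (G.len e))‖
  else ‖(s : AddCircle (G.len e))‖ + ‖(t : AddCircle (G.len f))‖

lemma continuous_flowerDist (e : E) (s : ℝ) (f : E) : Continuous (G.flowerDist e s f) := by
  unfold flowerDist
  split_ifs
  · exact continuous_norm_addCircle
  · exact continuous_const.add (by simpa using continuous_norm_addCircle (l := G.len f) (s := 0))

/-- Gluing the vertices together does not increase distances. -/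
lemma Connected.flowerDist_le (hG : G.Connected) {e f : E} {s t : ℝ}
    (hs : s ∈ Set.Icc 0 (G.len e)) (ht : t ∈ Set.Icc 0 (G.len f)) :
    G.flowerDist e s f t ≤ G.dist (G.pt e s) (G.pt f t) := by
  obtain ⟨φ, -, h2, h3⟩ := hG.exists_lift (fun _ => ‖(s : AddCircle (G.len e))‖)
    (G.flowerDist e s) (fun f => by
      unfold flowerDist
      split_ifs
      · rw [zero_sub, AddCircle.coe_neg, norm_neg]
      · simp) (fun f => by
      unfold flowerDist
      split_ifs with h
      · rw [h, norm_addCircle_period_sub]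
      · simp [AddCircle.coe_period]) (fun f x _ y _ => by
      unfold flowerDist
      rw [Real.dist_eq]
      split_ifs
      · refine abs_norm_sub_norm_addCircle_le.trans_eq ?_
        rw [sub_sub_sub_cancel_right]
      · rw [add_sub_add_left_eq_sub]
        exact abs_norm_sub_norm_addCircle_le)
  have h4 := h3 (G.pt e s) (G.pt f t)
  rw [h2 e s hs, h2 f t ht, Real.dist_eq, abs_sub_comm] at h4
  have h5 : G.flowerDist e s e s = 0 := by simp [flowerDist]
  rw [h5, sub_zero] at h4
  exact (le_abs_self _).trans h4

lemma Connected.dist_le_flowerDist (hG : G.Connected) {c : V} (hc : ∀ v, v = c) {e f : E}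
    {s t : ℝ} (hs : s ∈ Set.Icc 0 (G.len e)) (ht : t ∈ Set.Icc 0 (G.len f)) :
    G.dist (G.pt e s) (G.pt f t) ≤ G.flowerDist e s f t := by
  unfold flowerDist
  split_ifs with h
  · subst h
    have h1 := dist_pt_le (G := G) f s t
    have h2 : |t - s| ≤ G.len f := abs_le.2 ⟨by linarith [hs.2, ht.1], by linarith [hs.1, ht.2]⟩
    refine le_trans (le_min ?_ ?_) (min_le_norm_addCircle h2)
    · rwa [abs_sub_comm]
    · -- The other way round the loop passes through the vertex.
      have h3 := hG.dist_triangle (G.pt f s) (G.vtx c) (G.pt f t)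
      rw [dist_comm (G.vtx c)] at h3
      have h4 := dist_pt_ini_le hs
      have h5 := dist_pt_ter_le hs
      have h6 := dist_pt_ini_le ht
      have h7 := dist_pt_ter_le ht
      rw [hc (G.ini f)] at h4 h6
      rw [hc (G.ter f)] at h5 h7
      rcases abs_cases (t - s) with ⟨h8, -⟩ | ⟨h8, -⟩ <;> linarith
  · have key : ∀ (f : E) (t : ℝ), t ∈ Set.Icc 0 (G.len f) →
        G.dist (G.pt f t) (G.vtx c) ≤ ‖(t : AddCircle (G.len f))‖ := fun f t ht => by
      have h1 := dist_pt_ini_le ht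
      have h2 := dist_pt_ter_le ht
      rw [hc (G.ini f)] at h1
      rw [hc (G.ter f)] at h2
      have h3 : |t| ≤ G.len f := (abs_of_nonneg ht.1).trans_le ht.2
      refine le_trans ?_ (min_le_norm_addCircle h3)
      rw [abs_of_nonneg ht.1]
      exact le_min h1 h2
    refine (hG.dist_triangle _ (G.vtx c) _).trans (add_le_add (key e s hs) ?_)
    rw [dist_comm]
    exact key f t ht

lemma Connected.integral_flowerDist_le (hG : G.Connected) {e : E} {s : ℝ}
    (hs : s ∈ Set.Icc 0 (G.len e)) (f : E) :
    ∫ t in 0..G.len f, G.flowerDist e s f t ≤ ∫ t in 0..G.len f, G.dist (G.pt e s) (G.pt f t) :=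
  integral_mono_on (G.len_pos f).le ((continuous_flowerDist e s f).intervalIntegrable _ _)
    ((hG.continuous_dist_pt_right _ f).intervalIntegrable _ _) fun _ ht => hG.flowerDist_le hs ht

variable [Fintype E]

lemma sum_integral_flowerDist (e : E) (s : ℝ) :
    ∑ f, ∫ t in 0..G.len f, G.flowerDist e s f t = (∑ f, G.len f ^ 2) / 4 +
      (G.length Finset.univ - G.len e) * ‖(s : AddCircle (G.len e))‖ := by
  classical
  have h : ∀ f, ∫ t in 0..G.len f, G.flowerDist e s f t =
      G.len f ^ 2 / 4 + G.len f * ‖(s : AddCircle (G.len e))‖ -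
        if f = e then G.len e * ‖(s : AddCircle (G.len e))‖ else 0 := by
    intro f
    unfold flowerDist
    split_ifs with hf
    · subst hf
      rw [integral_norm_addCircle (G.len_pos f)]
      ring
    · have h0 := integral_norm_addCircle (G.len_pos f) 0
      have hc := continuous_norm_addCircle (l := G.len f) (s := 0)
      simp only [sub_zero] at h0 hc
      rw [integral_add (continuous_const.intervalIntegrable _ _) (hc.intervalIntegrable _ _), h0,
        integral_const, smul_eq_mul]
      ring
  simp_rw [h]
  rw [Finset.sum_sub_distrib, Finset.sum_add_distrib, Finset.sum_ite_eq' Finset.univ e,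
    if_pos (Finset.mem_univ _), ← Finset.sum_mul, ← Finset.sum_div, length]
  ring

lemma continuous_sum_integral_flowerDist (e : E) :
    Continuous fun s => ∑ f, ∫ t in 0..G.len f, G.flowerDist e s f t := by
  simp_rw [sum_integral_flowerDist]
  have hc := continuous_norm_addCircle (l := G.len e) (s := 0)
  simp only [sub_zero] at hc
  exact continuous_const.add (continuous_const.mul hc)

lemma sum_integral_sum_integral_flowerDist :
    ∑ e, ∫ s in 0..G.len e, ∑ f, ∫ t in 0..G.len f, G.flowerDist e s f t =
      (2 * G.length Finset.univ * ∑ e, G.len e ^ 2 - ∑ e, G.len e ^ 3) / 4 := by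
  have h : ∀ e, ∫ s in 0..G.len e, ∑ f, ∫ t in 0..G.len f, G.flowerDist e s f t =
      G.len e * ((∑ f, G.len f ^ 2) / 4) + G.length Finset.univ / 4 * G.len e ^ 2 -
        G.len e ^ 3 / 4 := by
    intro e
    simp_rw [sum_integral_flowerDist]
    have h0 := integral_norm_addCircle (G.len_pos e) 0
    have hc := continuous_norm_addCircle (l := G.len e) (s := 0)
    simp only [sub_zero] at h0 hc
    rw [integral_add (continuous_const.intervalIntegrable _ _)
      ((hc.const_mul (G.length Finset.univ - G.len e)).intervalIntegrable _ _), integral_const,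
      integral_const_mul, h0,
      smul_eq_mul]
    ring
  simp_rw [h]
  rw [Finset.sum_sub_distrib, Finset.sum_add_distrib, ← Finset.sum_mul, ← Finset.mul_sum,
    ← Finset.sum_div, length]
  ring

lemma Connected.sum_integral_flowerDist_le (hG : G.Connected) {e : E} {s : ℝ}
    (hs : s ∈ Set.Icc 0 (G.len e)) :
    ∑ f, ∫ t in 0..G.len f, G.flowerDist e s f t ≤ G.distInt Finset.univ (G.pt e s) :=
  Finset.sum_le_sum fun f _ => hG.integral_flowerDist_le hs f

lemma Connected.integral_sum_integral_flowerDist_le (hG : G.Connected) (e : E) :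
    ∫ s in 0..G.len e, ∑ f, ∫ t in 0..G.len f, G.flowerDist e s f t ≤
      ∫ s in 0..G.len e, G.distInt Finset.univ (G.pt e s) :=
  integral_mono_on (G.len_pos e).le
    ((continuous_sum_integral_flowerDist e).intervalIntegrable _ _)
    ((hG.continuous_distInt _ e).intervalIntegrable _ _)
    fun _ hs => hG.sum_integral_flowerDist_le hs

theorem Connected.le_distInt₂ (hG : G.Connected) :
    (2 * G.length Finset.univ * ∑ e, G.len e ^ 2 - ∑ e, G.len e ^ 3) / 4 ≤
      G.distInt₂ Finset.univ := by
  rw [← sum_integral_sum_integral_flowerDist]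
  exact Finset.sum_le_sum fun e _ => hG.integral_sum_integral_flowerDist_le e

/-- Gluing the vertices together changes the mean distance unless there is only one vertex. -/
theorem Connected.distInt₂_eq_iff (hG : G.Connected) :
    G.distInt₂ Finset.univ =
        (2 * G.length Finset.univ * ∑ e, G.len e ^ 2 - ∑ e, G.len e ^ 3) / 4 ↔
      ∃ c : V, ∀ v, v = c := by
  rw [← sum_integral_sum_integral_flowerDist]
  constructor
  · intro h
    have h1 := (Finset.sum_eq_sum_iff_of_le
      fun e _ => hG.integral_sum_integral_flowerDist_le e).1 h.symm
    have hloop : ∀ e, G.ini e = G.ter e := by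
      intro e
      have hl := G.len_pos e
      have h2 := eqOn_of_integral_eq hl (continuous_sum_integral_flowerDist e)
        (hG.continuous_distInt Finset.univ e) (fun s hs => hG.sum_integral_flowerDist_le hs)
        (h1 e (Finset.mem_univ e)).ge 0 ⟨le_rfl, hl.le⟩
      have h3 := (Finset.sum_eq_sum_iff_of_le
        fun f _ => hG.integral_flowerDist_le (e := e) ⟨le_rfl, hl.le⟩ f).1 h2 e (Finset.mem_univ e)
      have h4 := eqOn_of_integral_eq hl (continuous_flowerDist e 0 e)
        (hG.continuous_dist_pt_right (G.pt e 0) e)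
        (fun t ht => hG.flowerDist_le ⟨le_rfl, hl.le⟩ ht) h3.ge _ ⟨hl.le, le_rfl⟩
      by_contra hne
      have h5 := hG.dist_vtx_pos hne
      rw [← pt_zero, ← pt_len, ← h4] at h5
      simp [flowerDist, AddCircle.coe_period] at h5
    obtain ⟨c⟩ := hG.1
    have hW := hG.eq_univ_of_closed (W := {c}) ⟨c, rfl⟩ fun e => by rw [hloop e]
    exact ⟨c, fun v => hW.ge (Set.mem_univ v)⟩
  · rintro ⟨c, hc⟩
    refine Finset.sum_congr rfl fun e _ => integral_congr fun s hs => ?_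
    rw [Set.uIcc_of_le (G.len_pos e).le] at hs
    refine Finset.sum_congr rfl fun f _ => integral_congr fun t ht => ?_
    rw [Set.uIcc_of_le (G.len_pos f).le] at ht
    exact le_antisymm (hG.dist_le_flowerDist hc hs ht) (hG.flowerDist_le hs ht)

end Flower

end MetricGraph

theorem mainTheorem1 {V E : Type*} [Fintype V] [Fintype E] (G : MetricGraph V E)
    (hG : G.Connected) (L : ℝ) (hL : G.totalLength = L) (hL0 : 0 < L) :
    (2 * (Fintype.card E : ℝ) - 1) / (4 * (Fintype.card E : ℝ) ^ 2) * L ≤ G.meanDist ∧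
    G.meanDist ≤ L / 3 ∧
    (G.meanDist = (2 * (Fintype.card E : ℝ) - 1) / (4 * (Fintype.card E : ℝ) ^ 2) * L ↔
      G.IsEquilateralFlower) ∧
    (G.meanDist = L / 3 ↔ G.IsPathGraph) ∧
    (G.DoublyConnected →
      G.meanDist ≤ L / 4 ∧ (G.meanDist = L / 4 ↔ G.IsLoop)) := by
  have hE : Nonempty E := by
    by_contra h
    rw [not_nonempty_iff] at h
    simp [MetricGraph.totalLength] at hL
    linarith
  have hLen : G.length Finset.univ = L := hL
  have hL2 : 0 < L ^ 2 := by positivity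
  have hle : ∀ c : ℝ, G.meanDist ≤ c * L ↔ G.distInt₂ Finset.univ ≤ c * L ^ 3 := fun c => by
    rw [MetricGraph.meanDist_eq, hL, div_le_iff₀ hL2, mul_assoc, ← pow_succ']
  have hge : ∀ c : ℝ, c * L ≤ G.meanDist ↔ c * L ^ 3 ≤ G.distInt₂ Finset.univ := fun c => by
    rw [MetricGraph.meanDist_eq, hL, le_div_iff₀ hL2, mul_assoc, ← pow_succ']
  have heq : ∀ c : ℝ, G.meanDist = c * L ↔ G.distInt₂ Finset.univ = c * L ^ 3 := fun c => by
    rw [MetricGraph.meanDist_eq, hL, div_eq_iff hL2.ne', mul_assoc, ← pow_succ']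
  obtain ⟨hc1, hc2⟩ := MetricGraph.cubic_lower_bound G.len G.len_pos L hL hL0
  have hlow := hG.le_distInt₂
  have hloweq := hG.distInt₂_eq_iff
  have hN : (2 * (Fintype.card E : ℝ) - 1) / (4 * (Fintype.card E : ℝ) ^ 2) * L ^ 3 =
      (2 * (Fintype.card E : ℝ) - 1) / (Fintype.card E : ℝ) ^ 2 * L ^ 3 / 4 := by
    rw [mul_comm (4 : ℝ), ← div_div]
    ring
  rw [hLen] at hlow hloweq
  have h3 : L / 3 = 1 / 3 * L := by ring
  have h4 : L / 4 = 1 / 4 * L := by ring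
  have h3' : 1 / 3 * L ^ 3 = L ^ 3 / 3 := by ring
  have h4' : 1 / 4 * L ^ 3 = L ^ 3 / 4 := by ring
  have hup := hG.distInt₂_le
  rw [hLen] at hup
  rw [h3, h4, hge, hle, hle, heq, heq, heq, hN, h3', h4']
  refine ⟨by linarith, hup, ⟨fun h => ?_, ?_⟩, ⟨fun h => ?_, fun h => ?_⟩, fun hD => ?_⟩
  · exact ⟨hloweq.1 (by linarith), hc2.1 (by linarith)⟩
  · rintro ⟨h1, h2⟩
    rw [hloweq.2 h1, hc2.2 h2]
  · exact hG.isPathGraph_of_distInt₂_eq (by rw [hLen, h])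
  · have := h.le_distInt₂ hG
    rw [hLen] at this
    exact le_antisymm hup this
  · have hup' := hD.distInt₂_le
    rw [hLen] at hup'
    refine ⟨hup', fun h => hD.isLoop_of_distInt₂_eq (by rw [hLen, h]), fun h => ?_⟩
    have := h.le_distInt₂ hG
    rw [hLen] at this
    exact le_antisymm hup' this
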